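/- Let $D\subset\mathbb R^3$ be a bounded open set with Lipschitz boundary $S=\partial D$ (near each point of $S$, in suitable orthonormal coordinates, $D$ is the region below the graph of a Lipschitz function). Let $\mathrm dS$ be the surface area measure on $S$ and let $\boldsymbol n$ be the outward unit normal of $D$, which exists at almost every point of $S$. Write $G(\boldsymbol x,\boldsymbol y)=1/|\boldsymbol x-\boldsymbol y|$, and for a function $u$ write $\partial u/\partial n=\nabla u\cdot\boldsymbol n$ on $S$; in $\partial G(\boldsymbol x,\boldsymbol y)/\partial n$ the derivative is taken in $\boldsymbol x$. Let $\phi$ be harmonic in $D$ and continuously differentiable on $\overline D$. Let $\boldsymbol x_0\in S$ be a boundary point at which the outward unit normal $\boldsymbol n_0=\boldsymbol n(\boldsymbol x_0)$ exists, and write $(\partial\phi/\partial n)_0=\nabla\phi(\boldsymbol x_0)\cdot\boldsymbol n_0$. Let $f$ be harmonic in $D$ and continuously differentiable on $\overline D$ with $$f(\boldsymbol x_0)=0,\qquad \nabla f(\boldsymbol x_0)\cdot\boldsymbol n_0=1,$$ and put $$\psi(\boldsymbol x)=\phi(\boldsymbol x_0)+\Big(\frac{\partial\phi}{\partial n}\Big)_0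 f(\boldsymbol x).$$ Then for every interior point $\boldsymbol x_p\in D$ (in particular for $\boldsymbol x_p=\boldsymbol x_0-\varepsilon\boldsymbol n_0\in D$ with $\varepsilon>0$) the two integrals below converge absolutely and $$ \begin{aligned} \phi(\boldsymbol x_p)={}&\phi(\boldsymbol x_0)+\Big(\frac{\partial\phi}{\partial n}\Big)_0 f(\boldsymbol x_p)\\ &-\frac1{4\pi}\int_S\big\{\phi(\boldsymbol x)-\psi(\boldsymbol x)\big\}\Big\{\frac{\partial G(\boldsymbol x,\boldsymbol x_p)}{\partial n}-\frac{\partial G(\boldsymbol x,\boldsymbol x_0)}{\partial n}\Big\}\,\mathrm dS(\boldsymbol x)\\ &+\frac1{4\pi}\int_S\Big\{\frac{\partial\phi}{\partial n}(\boldsymbol x)-\Big(\frac{\partial\phi}{\partial n}\Big)_0\nabla f(\boldsymbol x)\cdot\boldsymbol n(\boldsymbol x)\Big\}\big\{G(\boldsymbol x,\boldsymbol x_p)-G(\boldsymbol x,\boldsymbol x_0)\big\}\,\mathrm dS(\boldsymbol x). \end{aligned} $$ -/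

import Mathlib

open MeasureTheory Set Filter Topology InnerProductSpace

/-- Euclidean three-space. -/
abbrev E3 : Type := EuclideanSpace ℝ (Fin 3)

/-- A bounded open set `D` in space whose boundary is locally, in suitable orthonormal
coordinates, the graph of a Lipschitz function with `D` lying below the graph.
The set `D` need not be connected, nor its boundary. -/
structure IsLipschitzDomain (D : Set E3) : Prop where
  isOpen : IsOpen D
  isBounded : Bornology.IsBounded D
  locally_below_graph : ∀ p ∈ frontier D,
    ∃ (e : E3 ≃ₗᵢ[ℝ] WithLp 2 (EuclideanSpace ℝ (Fin 2) × ℝ))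
      (γ : EuclideanSpace ℝ (Fin 2) → ℝ) (K : NNReal), LipschitzWith K γ ∧
      ∀ᶠ x in 𝓝 p, (x ∈ D ↔ (e x).snd < γ (e x).fst)

/-- `ν` is the outward unit normal of `D` at `x`: seen from `x`, up to an error of lower order,
`D` is the half-space `{y | ⟪ν, y - x⟫ < 0}` and its complement is the opposite half-space. -/
def IsOutwardUnitNormal (D : Set E3) (x ν : E3) : Prop :=
  ‖ν‖ = 1 ∧ ∀ ε : ℝ, 0 < ε → ∀ᶠ y in 𝓝 x,
    (y ∈ D → inner ℝ ν (y - x) ≤ ε * ‖y - x‖) ∧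
    (y ∉ D → -(ε * ‖y - x‖) ≤ inner ℝ ν (y - x))

theorem IsOutwardUnitNormal.inner_nonpos {D : Set E3} {x ν ν' w : E3}
    (h : IsOutwardUnitNormal D x ν) (h' : IsOutwardUnitNormal D x ν')
    (hw : inner ℝ ν w < 0) : inner ℝ ν' w ≤ 0 := by
  have hw0 : 0 < ‖w‖ := norm_pos_iff.mpr (by rintro rfl; simp at hw)
  by_contra hpos
  push Not at hpos
  set ε : ℝ := min (-inner ℝ ν w) (inner ℝ ν' w) / (2 * ‖w‖) with hε
  have hm : 0 < min (-inner ℝ ν w) (inner ℝ ν' w) := lt_min (by linarith) hpos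
  have hε0 : 0 < ε := by positivity
  have hεw : ε * ‖w‖ = min (-inner ℝ ν w) (inner ℝ ν' w) / 2 := by
    rw [hε]; field_simp
  have hlim : Tendsto (fun t : ℝ => x + t • w) (𝓝[>] 0) (𝓝 x) := by
    have : Continuous (fun t : ℝ => x + t • w) := by fun_prop
    have h0 := this.tendsto 0
    simp only [zero_smul, add_zero] at h0
    exact h0.mono_left nhdsWithin_le_nhds
  obtain ⟨t, ⟨h1, h2⟩, ht⟩ := ((hlim.eventually ((h.2 ε hε0).and (h'.2 ε hε0))).and
    self_mem_nhdsWithin).exists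
  have ht : (0 : ℝ) < t := ht
  have l1 := min_le_left (-inner ℝ ν w) (inner ℝ ν' w)
  have l2 := min_le_right (-inner ℝ ν w) (inner ℝ ν' w)
  simp only [add_sub_cancel_left, inner_smul_right, norm_smul, Real.norm_eq_abs,
    abs_of_pos ht] at h1 h2
  by_cases hD : x + t • w ∈ D
  · have := h2.1 hD
    have : t * (ε * ‖w‖) < t * inner ℝ ν' w := by
      apply mul_lt_mul_of_pos_left _ ht; linarith
    nlinarith
  · have := h1.2 hD
    have : t * inner ℝ ν w < t * (-(ε * ‖w‖)) := by
      apply mul_lt_mul_of_pos_left _ ht; linarith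
    nlinarith

/-- The outward unit normal at a point is unique. -/
theorem IsOutwardUnitNormal.unique {D : Set E3} {x ν ν' : E3}
    (h : IsOutwardUnitNormal D x ν) (h' : IsOutwardUnitNormal D x ν') : ν = ν' := by
  by_contra hne
  have hlt : inner ℝ ν ν' < 1 := inner_lt_one_iff_real_of_norm_eq_one h.1 h'.1 |>.mpr hne
  have hν : inner ℝ ν ν = 1 := by rw [real_inner_self_eq_norm_sq, h.1]; norm_num
  have hν' : inner ℝ ν' ν' = 1 := by rw [real_inner_self_eq_norm_sq, h'.1]; norm_num
  have := h.inner_nonpos h' (w := ν' - ν) (by rw [inner_sub_right]; linarith)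
  rw [inner_sub_right, real_inner_comm ν ν'] at this
  linarith

open Classical in
/-- The outward unit normal `n(x)` of `D` at `x` (zero where there is none). -/
noncomputable def outwardNormal (D : Set E3) (x : E3) : E3 :=
  if h : ∃ ν, IsOutwardUnitNormal D x ν then h.choose else 0

/-- The area measure on the boundary surface of `D`. -/
noncomputable def surfaceMeasure (D : Set E3) : Measure E3 :=
  (Measure.euclideanHausdorffMeasure 2).restrict (frontier D)

/-- The normal derivative `∂u/∂n = ∇u(x) · n(x)` at a point `x` of the boundary of `D`, where the
gradient is the one of `u` as a function on the closure of `D`. -/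
noncomputable def normalDeriv (D : Set E3) (u : E3 → ℝ) (x : E3) : ℝ :=
  inner ℝ (gradientWithin u (closure D) x) (outwardNormal D x)

/-- The free space Green's function `G(x, y) = 1 / |x - y|`. -/
noncomputable def greenG (x y : E3) : ℝ := 1 / ‖x - y‖

/-- The normal derivative `∂G(x, y)/∂n` with respect to the first variable `x`. -/
noncomputable def normalDerivG (D : Set E3) (x y : E3) : ℝ :=
  normalDeriv D (fun z => greenG z y) x

/-- `u` is harmonic in `D` and continuously differentiable up to the boundary of `D`. -/
structure IsHarmonicC1 (D : Set E3) (u : E3 → ℝ) : Prop where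
  harmonic : HarmonicOnNhd u D
  contDiffOn : ContDiffOn ℝ 1 u (closure D)

/-- The function `ψ(x) = φ(x₀) + (∂φ/∂n)₀ f(x)`. -/
noncomputable def psi (D : Set E3) (φ f : E3 → ℝ) (x₀ x : E3) : ℝ :=
  φ x₀ + normalDeriv D φ x₀ * f x

/-! Put `u = φ - ψ`. It is harmonic in `D`, continuously differentiable on the closure, and `u x₀ =
0`. The claim is the difference of two instances of Green's representation `4π u(y) = ∫ (∂u/∂n G(x,
y) - u ∂G(x, y)/∂n) dS`, at `y = xp` and at `y = x₀` (`IsHarmonicC1.representation`). At a boundary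
point the left side would normally carry a solid-angle factor; here `u x₀ = 0` makes that factor
irrelevant and gives `|u x| ≤ C |x - x₀|`, so that `u ∂G/∂n` is of order `1/|x - x₀|`, which is
integrable over a Lipschitz surface.

Both instances have one proof. No ball around `y` is removed; the kernel `1/r` is replaced by
`1/√(r² + δ²)`, smooth on all of space. Its negative Laplacian is `4π` times an approximate
identity, so the volume term of Green's second identity tends to `4π u(y)` as soon as `u`, extended
by zero outside `D`, is continuous at `y`. This holds if `y ∈ D` or `u y = 0`. The surface terms
converge by domination with a multiple of `1/|x - y|`.

Green's identity rests on the divergence theorem for fields continuous on the closure, `C¹` inside,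
with integrable divergence. A partition of unity reduces it to one chart. There the graph is lowered
by `s`, which brings the integration into the region where the field is smooth, and `s → 0`. Below a
Lipschitz graph the formula comes from differentiating the integral of a translated function: the
change is the integral over a thin layer between two graphs, whose relative thickness converges
almost everywhere by Rademacher's theorem. Finally `measure_graphMap_image` identifies the Hausdorff
measure of the graph with the density `√(1 + |∇γ|²)`. -/

section

open scoped NNReal ENNReal Manifold ContDiff

/-! ### Area of Lipschitz graphs -/

/-- The assignment `g x ↦ f x` is well defined and `K`-Lipschitz on `g '' s`, since equal values of
`g` force equal values of `f`. The symmetric form lets a graph and its linear model be compared in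
both directions. -/
theorem hausdorffMeasure_image_le_of_dist_le {α X Y : Type*} [MetricSpace X] [MeasurableSpace X]
    [BorelSpace X] [MetricSpace Y] [MeasurableSpace Y] [BorelSpace Y] {f : α → X} {g : α → Y}
    {s : Set α} {K : ℝ≥0} (h : ∀ x ∈ s, ∀ y ∈ s, dist (f x) (f y) ≤ K * dist (g x) (g y)) (d : ℕ) :
    Measure.euclideanHausdorffMeasure d (f '' s) ≤
      (K : ℝ≥0∞) ^ d * Measure.euclideanHausdorffMeasure d (g '' s) := by
  rcases s.eq_empty_or_nonempty with rfl | ⟨a, ha⟩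
  · simp
  have : Nonempty α := ⟨a⟩
  set k : Y → X := fun z => f (Function.invFunOn g s z) with hk
  have hinv : ∀ x ∈ s, Function.invFunOn g s (g x) ∈ s ∧ g (Function.invFunOn g s (g x)) = g x :=
    fun x hx => ⟨Function.invFunOn_mem ⟨x, hx, rfl⟩, Function.invFunOn_eq ⟨x, hx, rfl⟩⟩
  have hkf : ∀ x ∈ s, k (g x) = f x := by
    intro x hx
    obtain ⟨h1, h2⟩ := hinv x hx
    have := h _ h1 x hx
    rw [h2, dist_self, mul_zero] at this
    exact dist_le_zero.1 this
  have him : f '' s = k '' (g '' s) := by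
    rw [image_image]
    exact image_congr fun x hx => (hkf x hx).symm
  have hL : LipschitzOnWith K k (g '' s) := by
    apply LipschitzOnWith.of_dist_le_mul
    rintro _ ⟨x, hx, rfl⟩ _ ⟨y, hy, rfl⟩
    rw [hkf x hx, hkf y hy]
    exact h x hx y hy
  have := hL.hausdorffMeasure_image_le (d := (d : ℝ)) (by positivity)
  rw [him, Measure.euclideanHausdorffMeasure_def, Measure.euclideanHausdorffMeasure_def,
    Measure.smul_apply, Measure.smul_apply, mul_smul_comm]
  rw [ENNReal.rpow_natCast] at this
  gcongr

/-- The Euclidean plane. -/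
abbrev E2 : Type := EuclideanSpace ℝ (Fin 2)

/-- The graph parametrization of a function of two variables. -/
def graphMap (γ : E2 → ℝ) (y : E2) : WithLp 2 (E2 × ℝ) := WithLp.toLp 2 (y, γ y)

/-- The non-normalized upward normal `(-∇γ, 1)` of the graph of `γ`. -/
noncomputable def graphNormal (γ : E2 → ℝ) (y : E2) : WithLp 2 (E2 × ℝ) :=
  WithLp.toLp 2 (-gradient γ y, 1)

/-- The linear parametrization of the graph of a linear form. -/
def linGraph (a : E2 →L[ℝ] ℝ) : E2 →ₗ[ℝ] WithLp 2 (E2 × ℝ) where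
  toFun y := WithLp.toLp 2 (y, a y)
  map_add' x y := by simp [← WithLp.toLp_add]
  map_smul' c x := by simp [← WithLp.toLp_smul]

theorem linGraph_apply (a : E2 →L[ℝ] ℝ) (y : E2) : linGraph a y = WithLp.toLp 2 (y, a y) := rfl

theorem norm_sq_toLp (y : E2) (t : ℝ) :
    ‖(WithLp.toLp 2 (y, t) : WithLp 2 (E2 × ℝ))‖ ^ 2 = ‖y‖ ^ 2 + t ^ 2 := by
  rw [WithLp.prod_norm_sq_eq_of_L2]; simp

theorem norm_le_norm_toLp (y : E2) (t : ℝ) :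
    ‖y‖ ≤ ‖(WithLp.toLp 2 (y, t) : WithLp 2 (E2 × ℝ))‖ := by
  refine le_of_sq_le_sq ?_ (norm_nonneg _)
  rw [norm_sq_toLp]; nlinarith [sq_nonneg t]

theorem one_le_norm_toLp_one (y : E2) :
    1 ≤ ‖(WithLp.toLp 2 (y, (1 : ℝ)) : WithLp 2 (E2 × ℝ))‖ := by
  refine le_of_sq_le_sq ?_ (norm_nonneg _)
  rw [norm_sq_toLp]; nlinarith [sq_nonneg ‖y‖]

/-- The Gram matrix of the parametrization has determinant `(1 + a₀²)(1 + a₁²) - (a₀ a₁)² = 1 + a₀²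
+ a₁²`. -/
theorem normDet_linGraph (a : E2 →L[ℝ] ℝ) :
    (linGraph a).normDet =
      ‖(WithLp.toLp 2 (-(toDual ℝ E2).symm a, (1 : ℝ)) : WithLp 2 (E2 × ℝ))‖ := by
  have h := (linGraph a).normDet_sq_eq_det_gram (EuclideanSpace.basisFun (Fin 2) ℝ)
  refine (sq_eq_sq₀ (LinearMap.normDet_nonneg _) (norm_nonneg _)).1 ?_
  have hn : ‖(toDual ℝ E2).symm a‖ ^ 2 =
      a (EuclideanSpace.single 0 1) ^ 2 + a (EuclideanSpace.single 1 1) ^ 2 := by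
    have key : ∀ v, inner ℝ ((toDual ℝ E2).symm a) v = a v := fun v => by
      rw [toDual_symm_apply]
    rw [EuclideanSpace.norm_sq_eq, Fin.sum_univ_two, ← key, ← key,
      EuclideanSpace.inner_single_right, EuclideanSpace.inner_single_right]
    simp
  rw [norm_sq_toLp, norm_neg, hn]
  simp only [RCLike.ofReal_real_eq_id, id] at h
  rw [h, Matrix.det_fin_two]
  have h01 : inner ℝ (EuclideanSpace.single 0 1 : E2) (EuclideanSpace.single 1 1) = 0 := by
    rw [EuclideanSpace.inner_single_left]; simp
  have h10 : inner ℝ (EuclideanSpace.single 1 1 : E2) (EuclideanSpace.single 0 1) = 0 := by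
    rw [EuclideanSpace.inner_single_left]; simp
  simp [Matrix.gram, linGraph_apply, WithLp.prod_inner_apply, h01, h10]
  ring

theorem abs_norm_graphNormal_sub_le (a b : E2 →L[ℝ] ℝ) :
    |‖(WithLp.toLp 2 (-(toDual ℝ E2).symm a, (1 : ℝ)) : WithLp 2 (E2 × ℝ))‖ -
      ‖(WithLp.toLp 2 (-(toDual ℝ E2).symm b, (1 : ℝ)) : WithLp 2 (E2 × ℝ))‖| ≤ ‖a - b‖ := by
  refine (abs_norm_sub_norm_le _ _).trans ?_
  rw [← WithLp.toLp_sub, Prod.mk_sub_mk, sub_self, ← neg_sub', norm_sub_rev]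
  refine le_of_sq_le_sq ?_ (norm_nonneg _)
  rw [norm_sq_toLp, norm_neg, ← map_sub, LinearIsometryEquiv.norm_map, norm_sub_rev]
  simp

theorem norm_graphMap_sub_le {γ : E2 → ℝ} {K : ℝ≥0} (hγ : LipschitzWith K γ) (x y : E2) :
    ‖graphMap γ x - graphMap γ y‖ ≤ (1 + K) * ‖x - y‖ := by
  refine le_of_sq_le_sq ?_ (by positivity)
  have h := hγ.norm_sub_le x y
  rw [graphMap, graphMap, ← WithLp.toLp_sub, Prod.mk_sub_mk, norm_sq_toLp, mul_pow]
  have h2 : (γ x - γ y) ^ 2 ≤ (K * ‖x - y‖) ^ 2 := by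
    rw [← sq_abs]; gcongr; exact h
  nlinarith [sq_nonneg ‖x - y‖, K.coe_nonneg, mul_nonneg K.coe_nonneg (sq_nonneg ‖x-y‖)]

/-- Increments of the graph and of its linear model differ only vertically, by at most `δ ‖x - y‖`,
and `‖x - y‖` is at most the increment of the model. Distances thus agree up to factors `1 ± δ`, and
areas up to their squares. -/
theorem measure_graphMap_image_of_approximatesLinearOn {γ : E2 → ℝ} {a : E2 →L[ℝ] ℝ} {s : Set E2}
    {δ : ℝ≥0} (hδ : δ < 1) (h : ApproximatesLinearOn γ a s δ) :
    Measure.euclideanHausdorffMeasure 2 (graphMap γ '' s) ≤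
      ((1 + δ : ℝ≥0) : ℝ≥0∞) ^ 2 * (ENNReal.ofReal
        ‖(WithLp.toLp 2 (-(toDual ℝ E2).symm a, (1 : ℝ)) : WithLp 2 (E2 × ℝ))‖ * volume s) ∧
    ENNReal.ofReal
        ‖(WithLp.toLp 2 (-(toDual ℝ E2).symm a, (1 : ℝ)) : WithLp 2 (E2 × ℝ))‖ * volume s ≤
      (((1 - δ)⁻¹ : ℝ≥0) : ℝ≥0∞) ^ 2 *
        Measure.euclideanHausdorffMeasure 2 (graphMap γ '' s) := by
  have key : ENNReal.ofReal
      ‖(WithLp.toLp 2 (-(toDual ℝ E2).symm a, (1 : ℝ)) : WithLp 2 (E2 × ℝ))‖ * volume s =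
      Measure.euclideanHausdorffMeasure 2 (linGraph a '' s) := by
    rw [← normDet_linGraph, ← LinearMap.euclideanHausdorffMeasure_image_eq_normDet_mul_volume]
    simp
  have hd : ∀ x ∈ s, ∀ y ∈ s, ‖(graphMap γ x - graphMap γ y) - (linGraph a x - linGraph a y)‖ ≤
      δ * ‖linGraph a x - linGraph a y‖ := by
    intro x hx y hy
    have h1 := h x hx y hy
    have h2 : ‖x - y‖ ≤ ‖linGraph a x - linGraph a y‖ := by
      rw [← map_sub]; exact norm_le_norm_toLp _ _
    have h3 : (graphMap γ x - graphMap γ y) - (linGraph a x - linGraph a y) =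
        WithLp.toLp 2 (0, γ x - γ y - a (x - y)) := by
      simp only [graphMap, linGraph_apply, ← WithLp.toLp_sub, Prod.mk_sub_mk, sub_self, map_sub]
    have h4 : ‖(graphMap γ x - graphMap γ y) - (linGraph a x - linGraph a y)‖ =
        ‖γ x - γ y - a (x - y)‖ := by
      rw [h3]
      refine (sq_eq_sq₀ (norm_nonneg _) (norm_nonneg _)).1 ?_
      rw [norm_sq_toLp]; simp
    rw [h4]
    exact h1.trans (by gcongr)
  rw [key]
  constructor
  · apply hausdorffMeasure_image_le_of_dist_le
    intro x hx y hy
    rw [dist_eq_norm, dist_eq_norm]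
    have := norm_sub_norm_le (graphMap γ x - graphMap γ y) (linGraph a x - linGraph a y)
    have := hd x hx y hy
    push_cast; linarith
  · apply hausdorffMeasure_image_le_of_dist_le
    intro x hx y hy
    rw [dist_eq_norm, dist_eq_norm]
    have h1 := norm_sub_norm_le (linGraph a x - linGraph a y) (graphMap γ x - graphMap γ y)
    rw [norm_sub_rev (linGraph a x - linGraph a y) (graphMap γ x - graphMap γ y)] at h1
    have h2 := hd x hx y hy
    have h3 : (0 : ℝ) < 1 - δ := by
      have : (δ : ℝ) < 1 := by exact_mod_cast hδ
      linarith
    rw [NNReal.coe_inv, NNReal.coe_sub hδ.le, NNReal.coe_one, inv_mul_eq_div, le_div_iff₀ h3]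
    linarith

theorem measurable_graphNormal (γ : E2 → ℝ) : Measurable (graphNormal γ) := by
  have h : Measurable (gradient γ) :=
    (toDual ℝ E2).symm.continuous.measurable.comp (measurable_fderiv ℝ γ)
  exact (WithLp.measurable_toLp 2 _).comp (h.neg.prodMk measurable_const)

theorem measurableEmbedding_graphMap {γ : E2 → ℝ} (hc : Continuous γ) :
    MeasurableEmbedding (graphMap γ) := by
  have hgc : Continuous (graphMap γ) := by
    unfold graphMap
    exact (WithLp.prod_continuous_toLp 2 _ _).comp (by fun_prop)
  refine hgc.measurableEmbedding fun x y hxy => ?_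
  have := congrArg (fun z : WithLp 2 (E2 × ℝ) => z.fst) hxy
  simpa [graphMap] using this

/-- The normals have length at least one, so the additive error `δ` in the density becomes a
relative one. -/
theorem norm_normal_le_mul {δ : ℝ≥0} {a b : E2 →L[ℝ] ℝ} (hab : ‖a - b‖₊ ≤ δ) :
    ‖(WithLp.toLp 2 (-(toDual ℝ E2).symm a, (1 : ℝ)) : WithLp 2 (E2 × ℝ))‖ ≤
      (1 + δ) * ‖(WithLp.toLp 2 (-(toDual ℝ E2).symm b, (1 : ℝ)) : WithLp 2 (E2 × ℝ))‖ := by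
  have h1 := (abs_le.1 (abs_norm_graphNormal_sub_le a b)).2
  have h2 : ‖a - b‖ ≤ δ := hab
  have h4 := le_mul_of_one_le_right δ.2 (one_le_norm_toLp_one (-(toDual ℝ E2).symm b))
  change (δ : ℝ) ≤ δ * _ at h4
  linarith

theorem ae_norm_fderiv_sub_le_of_approximatesLinearOn {γ : E2 → ℝ} {a : E2 →L[ℝ] ℝ} {s : Set E2}
    {δ : ℝ≥0} (h : ApproximatesLinearOn γ a s δ) (hs : MeasurableSet s) {γ' : E2 → E2 →L[ℝ] ℝ}
    (hγ : ∀ x ∈ s, HasFDerivWithinAt γ (γ' x) s x) :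
    ∀ᵐ x ∂volume.restrict s, ‖γ' x - a‖₊ ≤ δ := by
  -- The estimate invoked below is for maps of a space to itself; multiplication by a unit vector
  -- makes `γ` such a map without changing any norm.
  set v : E2 := EuclideanSpace.single 0 1 with hv
  have hv1 : ‖v‖ = 1 := by simp [hv]
  have h1 : ApproximatesLinearOn (fun x => γ x • v) (a.smulRight v) s δ := by
    intro x hx y hy
    have := h x hx y hy
    rwa [ContinuousLinearMap.smulRight_apply, ← sub_smul, ← sub_smul, norm_smul, hv1, mul_one]
  have h2 := h1.norm_fderiv_sub_le volume hs (fun x => (γ' x).smulRight v)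
    fun x hx => (hγ x hx).smul_const v
  filter_upwards [h2] with x hx
  have e : (γ' x).smulRight v - a.smulRight v = (γ' x - a).smulRight v := by
    ext1 z; simp [sub_smul]
  rw [e] at hx
  have : ‖(γ' x - a).smulRight v‖ = ‖γ' x - a‖ := by
    rw [ContinuousLinearMap.norm_smulRight_apply, hv1, mul_one]
  rwa [← NNReal.coe_le_coe, coe_nnnorm, this] at hx

/-- Cut `s` into countably many pieces on which `γ` is `δ`-close to a linear form. On each piece,
replacing the graph by its linear model costs a square factor, and replacing the constant density of
the model by the true one costs another `1 + δ`. -/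
theorem measure_graphMap_image_bounds {γ : E2 → ℝ} {s : Set E2} (hs : MeasurableSet s)
    (hγ : ∀ x ∈ s, DifferentiableAt ℝ γ x) (hc : Continuous γ) {δ : ℝ≥0} (hδ : δ < 1)
    (hδ0 : δ ≠ 0) :
    Measure.euclideanHausdorffMeasure 2 (graphMap γ '' s) ≤
      ((1 + δ : ℝ≥0) : ℝ≥0∞) ^ 3 * ∫⁻ y in s, ENNReal.ofReal ‖graphNormal γ y‖ ∧
    ∫⁻ y in s, ENNReal.ofReal ‖graphNormal γ y‖ ≤
      (((1 + δ) * (1 - δ)⁻¹ ^ 2 : ℝ≥0) : ℝ≥0∞) *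
        Measure.euclideanHausdorffMeasure 2 (graphMap γ '' s) := by
  obtain ⟨t, A, tdisj, tmeas, st, tapp, -⟩ :=
    exists_partition_approximatesLinearOn_of_hasFDerivWithinAt γ s (fderiv ℝ γ)
      (fun x hx => (hγ x hx).hasFDerivAt.hasFDerivWithinAt) (fun _ => δ) (fun _ => hδ0)
  have hmeas : Measurable fun y => ENNReal.ofReal ‖graphNormal γ y‖ :=
    (measurable_graphNormal γ).norm.ennreal_ofReal
  have hemb := measurableEmbedding_graphMap hc
  have hsU : s = ⋃ n, s ∩ t n := by rw [← inter_iUnion]; exact (inter_eq_left.2 st).symm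
  have hdisj : Pairwise (Function.onFun Disjoint fun n => s ∩ t n) := fun i j hij =>
    (tdisj hij).mono inter_subset_right inter_subset_right
  have hm : ∀ n, MeasurableSet (s ∩ t n) := fun n => hs.inter (tmeas n)
  have e1 : Measure.euclideanHausdorffMeasure 2 (graphMap γ '' s) =
      ∑' n, Measure.euclideanHausdorffMeasure 2 (graphMap γ '' (s ∩ t n)) := by
    conv_lhs => rw [hsU, image_iUnion]
    refine measure_iUnion (fun i j hij => ?_) fun n => hemb.measurableSet_image.2 (hm n)
    exact (disjoint_image_iff hemb.injective).2 (hdisj hij)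
  have e2 : ∫⁻ y in s, ENNReal.ofReal ‖graphNormal γ y‖ =
      ∑' n, ∫⁻ y in s ∩ t n, ENNReal.ofReal ‖graphNormal γ y‖ := by
    conv_lhs => rw [hsU]
    exact lintegral_iUnion hm hdisj _
  have hae : ∀ n, ∀ᵐ y ∂volume.restrict (s ∩ t n), ‖fderiv ℝ γ y - A n‖₊ ≤ δ := by
    intro n
    have hd : ∀ x ∈ s ∩ t n, HasFDerivWithinAt γ (fderiv ℝ γ x) (s ∩ t n) x := fun x hx =>
      (hγ x hx.1).hasFDerivAt.hasFDerivWithinAt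
    exact ae_norm_fderiv_sub_le_of_approximatesLinearOn (tapp n) (hm n) hd
  obtain ⟨ρ, hρ⟩ : ∃ ρ : (E2 →L[ℝ] ℝ) → ℝ, ρ = fun a =>
    ‖(WithLp.toLp 2 (-(toDual ℝ E2).symm a, (1 : ℝ)) : WithLp 2 (E2 × ℝ))‖ := ⟨_, rfl⟩
  have hρg : ∀ y, ‖graphNormal γ y‖ = ρ (fderiv ℝ γ y) := fun y => by rw [hρ]; rfl
  have hcmp : ∀ a b : E2 →L[ℝ] ℝ, ‖a - b‖₊ ≤ δ → ρ a ≤ (1 + δ) * ρ b := by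
    intro a b hab
    rw [hρ]
    exact norm_normal_le_mul hab
  have happ : ∀ n, Measure.euclideanHausdorffMeasure 2 (graphMap γ '' (s ∩ t n)) ≤
      ((1 + δ : ℝ≥0) : ℝ≥0∞) ^ 2 * (ENNReal.ofReal (ρ (A n)) * volume (s ∩ t n)) ∧
      ENNReal.ofReal (ρ (A n)) * volume (s ∩ t n) ≤ (((1 - δ)⁻¹ : ℝ≥0) : ℝ≥0∞) ^ 2 *
        Measure.euclideanHausdorffMeasure 2 (graphMap γ '' (s ∩ t n)) := by
    intro n
    rw [hρ]
    exact measure_graphMap_image_of_approximatesLinearOn hδ (tapp n)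
  have hof : ∀ r, ENNReal.ofReal ((1 + δ) * r) = ((1 + δ : ℝ≥0) : ℝ≥0∞) * ENNReal.ofReal r := by
    intro r
    rw [ENNReal.ofReal_mul (by positivity)]
    congr 1
    rw [← NNReal.coe_one, ← NNReal.coe_add, ENNReal.ofReal_coe_nnreal]
  have i1 : ∀ n, ENNReal.ofReal (ρ (A n)) * volume (s ∩ t n) ≤
      ((1 + δ : ℝ≥0) : ℝ≥0∞) * ∫⁻ y in s ∩ t n, ENNReal.ofReal ‖graphNormal γ y‖ := by
    intro n
    rw [← lintegral_const_mul _ hmeas, ← setLIntegral_const]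
    refine lintegral_mono_ae ?_
    filter_upwards [hae n] with y hy
    rw [hρg, ← hof]
    refine ENNReal.ofReal_le_ofReal (hcmp _ _ ?_)
    rwa [← nnnorm_neg, neg_sub]
  have i2 : ∀ n, ∫⁻ y in s ∩ t n, ENNReal.ofReal ‖graphNormal γ y‖ ≤
      ((1 + δ : ℝ≥0) : ℝ≥0∞) * (ENNReal.ofReal (ρ (A n)) * volume (s ∩ t n)) := by
    intro n
    rw [← mul_assoc, ← setLIntegral_const]
    refine lintegral_mono_ae ?_
    filter_upwards [hae n] with y hy
    rw [hρg, ← hof]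
    exact ENNReal.ofReal_le_ofReal (hcmp _ _ hy)
  rw [e1, e2]
  constructor
  · rw [← ENNReal.tsum_mul_left]
    refine ENNReal.tsum_le_tsum fun n => ?_
    refine (happ n).1.trans ?_
    rw [pow_succ _ 2, mul_assoc]
    exact mul_le_mul_right (i1 n) _
  · rw [← ENNReal.tsum_mul_left]
    refine ENNReal.tsum_le_tsum fun n => ?_
    refine (i2 n).trans ?_
    rw [ENNReal.coe_mul, mul_assoc, ENNReal.coe_pow]
    exact mul_le_mul_right (happ n).2 _

/-- The area of a piece of a Lipschitz graph. -/
theorem measure_graphMap_image {γ : E2 → ℝ} {K : ℝ≥0} (hγ : LipschitzWith K γ) {s : Set E2}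
    (hs : MeasurableSet s) :
    Measure.euclideanHausdorffMeasure 2 (graphMap γ '' s) =
      ∫⁻ y in s, ENNReal.ofReal ‖graphNormal γ y‖ := by
  set d : Set E2 := {x | DifferentiableAt ℝ γ x} with hd
  have hdm : MeasurableSet d := measurableSet_of_differentiableAt ℝ γ
  have hd0 : volume dᶜ = 0 := hγ.ae_differentiableAt
  -- By Rademacher the exceptional set is null, and the Lipschitz map `graphMap γ` sends null sets
  -- to sets of zero area.
  have hz : Measure.euclideanHausdorffMeasure 2 (graphMap γ '' (s \ d)) = 0 := by
    have h0 : Measure.euclideanHausdorffMeasure 2 (id '' (s \ d) : Set E2) = 0 := by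
      rw [image_id, EuclideanSpace.euclideanHausdorffMeasure_eq_volume]
      exact measure_mono_null (fun x hx => hx.2) hd0
    have := hausdorffMeasure_image_le_of_dist_le (f := graphMap γ) (g := (id : E2 → E2))
      (s := s \ d) (K := 1 + K) (fun x _ y _ => by
        rw [dist_eq_norm, dist_eq_norm]; exact norm_graphMap_sub_le hγ x y) 2
    rw [h0, mul_zero] at this
    exact le_antisymm this bot_le
  have e1 : Measure.euclideanHausdorffMeasure 2 (graphMap γ '' s) =
      Measure.euclideanHausdorffMeasure 2 (graphMap γ '' (s ∩ d)) := by
    refine le_antisymm ?_ (measure_mono (image_mono inter_subset_left))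
    conv_lhs => rw [← inter_union_sdiff s d, image_union]
    refine (measure_union_le _ _).trans ?_
    rw [hz, add_zero]
  have e2 : ∫⁻ y in s, ENNReal.ofReal ‖graphNormal γ y‖ =
      ∫⁻ y in s ∩ d, ENNReal.ofReal ‖graphNormal γ y‖ := by
    refine setLIntegral_congr ?_
    refine (inter_ae_eq_left_of_ae_eq_univ ?_).symm
    exact ae_eq_univ.2 hd0
  rw [e1, e2]
  have hb := fun δ => measure_graphMap_image_bounds (γ := γ) (s := s ∩ d) (hs.inter hdm)
    (fun x hx => hx.2) hγ.continuous (δ := δ)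
  have hev : ∀ᶠ δ : ℝ≥0 in 𝓝[>] 0, δ < 1 ∧ δ ≠ 0 := by
    have h1 : ∀ᶠ δ : ℝ≥0 in 𝓝[>] 0, δ < 1 := nhdsWithin_le_nhds (gt_mem_nhds zero_lt_one)
    filter_upwards [h1, self_mem_nhdsWithin] with δ h1 h2 using ⟨h1, ne_of_gt h2⟩
  refine le_antisymm ?_ ?_
  · have hlim : Tendsto (fun δ : ℝ≥0 => ((1 + δ : ℝ≥0) : ℝ≥0∞) ^ 3 *
        ∫⁻ y in s ∩ d, ENNReal.ofReal ‖graphNormal γ y‖) (𝓝[>] 0)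
        (𝓝 (1 * ∫⁻ y in s ∩ d, ENNReal.ofReal ‖graphNormal γ y‖)) := by
      refine ENNReal.Tendsto.mul_const ?_ (Or.inl one_ne_zero)
      have : Continuous fun δ : ℝ≥0 => (1 + δ) ^ 3 := by fun_prop
      have h2 := (ENNReal.tendsto_coe.2 (this.tendsto 0)).mono_left
        (nhdsWithin_le_nhds (s := Ioi 0))
      simpa using h2
    rw [one_mul] at hlim
    refine ge_of_tendsto hlim ?_
    filter_upwards [hev] with δ h using (hb δ h.1 h.2).1
  · have hlim : Tendsto (fun δ : ℝ≥0 => (((1 + δ) * (1 - δ)⁻¹ ^ 2 : ℝ≥0) : ℝ≥0∞) *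
        Measure.euclideanHausdorffMeasure 2 (graphMap γ '' (s ∩ d))) (𝓝[>] 0)
        (𝓝 (1 * Measure.euclideanHausdorffMeasure 2 (graphMap γ '' (s ∩ d)))) := by
      refine ENNReal.Tendsto.mul_const ?_ (Or.inl one_ne_zero)
      have hc : ContinuousAt (fun δ : ℝ≥0 => (1 + δ) * (1 - δ)⁻¹ ^ 2) 0 := by
        have h1 : ContinuousAt (fun δ : ℝ≥0 => (1 - δ)) 0 := by fun_prop
        have h2 : ContinuousAt (fun δ : ℝ≥0 => 1 + δ) 0 := by fun_prop
        exact h2.mul ((h1.inv₀ (by simp)).pow 2)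
      have h2 := (ENNReal.tendsto_coe.2 hc.tendsto).mono_left
        (nhdsWithin_le_nhds (s := Ioi 0))
      simpa using h2
    rw [one_mul] at hlim
    refine ge_of_tendsto hlim ?_
    filter_upwards [hev] with δ h using (hb δ h.1 h.2).2

/-- The area measure of a Lipschitz graph in parametrized form. -/
theorem restrict_range_graphMap {γ : E2 → ℝ} {K : ℝ≥0} (hγ : LipschitzWith K γ) :
    (Measure.euclideanHausdorffMeasure 2).restrict (range (graphMap γ)) =
      (volume.withDensity fun y => ENNReal.ofReal ‖graphNormal γ y‖).map (graphMap γ) := by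
  have hemb := measurableEmbedding_graphMap hγ.continuous
  ext s hs
  rw [Measure.restrict_apply hs, Measure.map_apply hemb.measurable hs,
    withDensity_apply _ (hemb.measurable hs), ← measure_graphMap_image hγ (hemb.measurable hs),
    image_preimage_eq_inter_range]

/-! ### Integrating a partial derivative over a Lipschitz subgraph -/

instance isAddHaarMeasure_volume_prod : (volume : Measure (E2 × ℝ)).IsAddHaarMeasure :=
  Measure.prod.instIsAddHaarMeasure volume volume

theorem setIntegral_subgraph {h : E2 × ℝ → ℝ} (hh : Continuous h) (hc : HasCompactSupport h)
    {β : E2 → ℝ} (hβ : Continuous β) :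
    ∫ p in {p : E2 × ℝ | p.2 < β p.1}, h p = ∫ y, ∫ t in Iio (β y), h (y, t) := by
  have hm : MeasurableSet {p : E2 × ℝ | p.2 < β p.1} :=
    (isOpen_lt continuous_snd (hβ.comp continuous_fst)).measurableSet
  have hi : Integrable h := hh.integrable_of_hasCompactSupport hc
  rw [← integral_indicator hm, Measure.volume_eq_prod, integral_prod _ (hi.indicator hm)]
  refine integral_congr_ae (Eventually.of_forall fun y => ?_)
  simp only
  rw [← integral_indicator measurableSet_Iio]
  rfl

theorem integrable_slice {h : E2 × ℝ → ℝ} (hh : Continuous h) (hc : HasCompactSupport h) (y : E2) :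
    Integrable fun t => h (y, t) := by
  refine (hh.comp (Continuous.prodMk_right y)).integrable_of_hasCompactSupport ?_
  exact hc.comp_isClosedEmbedding (Function.LeftInverse.isClosedEmbedding (f := Prod.snd)
    (fun _ => rfl) continuous_snd (Continuous.prodMk_right y))

theorem integrable_setIntegral_slice {h : E2 × ℝ → ℝ} (hh : Continuous h)
    (hc : HasCompactSupport h) {β : E2 → ℝ} (hβ : Continuous β) :
    Integrable fun y => ∫ t in Iio (β y), h (y, t) := by
  have hm : MeasurableSet {p : E2 × ℝ | p.2 < β p.1} :=
    (isOpen_lt continuous_snd (hβ.comp continuous_fst)).measurableSet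
  have hi : Integrable h := hh.integrable_of_hasCompactSupport hc
  have h2 := (hi.indicator hm).integral_prod_left
  refine h2.congr (Eventually.of_forall fun y => ?_)
  simp only
  rw [← integral_indicator measurableSet_Iio]
  rfl

/-- Difference quotients of a Lipschitz function converge when tested against an integrable
function. The test function is the indicator of the subgraph, cut to a ball to be integrable. -/
theorem tendsto_difference_quotient_integral_subgraph {γ : E2 → ℝ} {K : ℝ≥0}
    (hγ : LipschitzWith K γ) {h : E2 × ℝ → ℝ} (hh : ContDiff ℝ 1 h) (hc : HasCompactSupport h)
    (v : E2 × ℝ) :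
    Tendsto (fun t : ℝ => t⁻¹ * ((∫ p in {p : E2 × ℝ | p.2 < γ p.1}, h (p + t • v)) -
      ∫ p in {p : E2 × ℝ | p.2 < γ p.1}, h p)) (𝓝[>] 0)
      (𝓝 (∫ p in {p : E2 × ℝ | p.2 < γ p.1}, fderiv ℝ h p v)) := by
  set Ω := {p : E2 × ℝ | p.2 < γ p.1} with hΩ
  have hm : MeasurableSet Ω :=
    (isOpen_lt continuous_snd (hγ.continuous.comp continuous_fst)).measurableSet
  obtain ⟨C, hC⟩ := hh.lipschitzWith_of_hasCompactSupport hc one_ne_zero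
  obtain ⟨R, hR⟩ := hc.isCompact.isBounded.subset_closedBall 0
  have hsupp : ∀ p, p ∉ Metric.closedBall (0 : E2 × ℝ) R → h p = 0 := fun p hp =>
    image_eq_zero_of_notMem_tsupport fun hp' => hp (hR hp')
  -- The extra `‖v‖` keeps the support of every translate `h (· + t • v)` with `0 < t ≤ 1` inside
  -- `B`.
  set B := Metric.closedBall (0 : E2 × ℝ) (R + ‖v‖) with hB
  have hBsub : Metric.closedBall (0 : E2 × ℝ) R ⊆ B :=
    Metric.closedBall_subset_closedBall (by linarith [norm_nonneg v])
  have hgm : MeasurableSet (Ω ∩ B) := hm.inter Metric.isClosed_closedBall.measurableSet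
  have hg : Integrable ((Ω ∩ B).indicator fun _ => (1 : ℝ)) := by
    refine (integrable_indicator_iff hgm).2 (integrableOn_const ?_)
    exact ((measure_mono inter_subset_right).trans_lt measure_closedBall_lt_top).ne
  have key := hC.integral_inv_smul_sub_mul_tendsto_integral_lineDeriv_mul hg v
  have hcut : ∀ f : E2 × ℝ → ℝ, (∀ p, p ∉ B → f p = 0) →
      ∫ p, f p * (Ω ∩ B).indicator (fun _ => (1 : ℝ)) p = ∫ p in Ω, f p := by
    intro f hf
    rw [← integral_indicator hm]
    refine integral_congr_ae (Eventually.of_forall fun p => ?_)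
    by_cases h1 : p ∈ Ω <;> by_cases h2 : p ∈ B <;> simp [h1, h2, indicator, hf]
  have hd : ∀ p, lineDeriv ℝ h p v = fderiv ℝ h p v := fun p =>
    ((hh.differentiable one_ne_zero) p).lineDeriv_eq_fderiv
  simp_rw [hd] at key
  rw [hcut _ fun p hp => by
    rw [fderiv_of_notMem_tsupport ℝ fun hp' => hp (hBsub (hR hp'))]; rfl] at key
  refine key.congr' ?_
  filter_upwards [Ioc_mem_nhdsGT (zero_lt_one' ℝ)] with t ht
  have hz : ∀ p, p ∉ B → h (p + t • v) = 0 := by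
    intro p hp
    refine hsupp _ fun hp' => hp ?_
    rw [hB, mem_closedBall_zero_iff]
    rw [mem_closedBall_zero_iff] at hp'
    calc ‖p‖ = ‖(p + t • v) - t • v‖ := by rw [add_sub_cancel_right]
      _ ≤ ‖p + t • v‖ + ‖t • v‖ := norm_sub_le _ _
      _ ≤ R + ‖v‖ := by
        rw [norm_smul, Real.norm_of_nonneg ht.1.le]
        nlinarith [norm_nonneg v, ht.2]
  have hi : Integrable h := hh.continuous.integrable_of_hasCompactSupport hc
  rw [hcut _ fun p hp => by rw [hz p hp, hsupp p fun hp' => hp (hBsub hp')]; simp,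
    ← integral_sub (hi.comp_add_right (t • v)).integrableOn hi.integrableOn, ← integral_const_mul]
  rfl

theorem setIntegral_subgraph_translate {γ : E2 → ℝ} (hγ : Continuous γ) (h : E2 × ℝ → ℝ)
    (v : E2 × ℝ) :
    ∫ p in {p : E2 × ℝ | p.2 < γ p.1}, h (p + v) =
      ∫ p in {p : E2 × ℝ | p.2 < γ (p.1 - v.1) + v.2}, h p := by
  have h1 : MeasurableSet {p : E2 × ℝ | p.2 < γ p.1} :=
    (isOpen_lt continuous_snd (hγ.comp continuous_fst)).measurableSet
  have h2 : MeasurableSet {p : E2 × ℝ | p.2 < γ (p.1 - v.1) + v.2} :=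
    (isOpen_lt continuous_snd (by fun_prop)).measurableSet
  rw [← integral_indicator h1, ← integral_indicator h2, 
    ← integral_add_right_eq_self
      (({p : E2 × ℝ | p.2 < γ (p.1 - v.1) + v.2} : Set (E2 × ℝ)).indicator h) v]
  refine integral_congr_ae (Eventually.of_forall fun p => ?_)
  simp [indicator]

/-- The integral of a directional derivative over the region below a Lipschitz graph. -/
theorem setIntegral_subgraph_fderiv {γ : E2 → ℝ} {K : ℝ≥0} (hγ : LipschitzWith K γ)
    {h : E2 × ℝ → ℝ} (hh : ContDiff ℝ 1 h) (hc : HasCompactSupport h) (v : E2 × ℝ) :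
    ∫ p in {p : E2 × ℝ | p.2 < γ p.1}, fderiv ℝ h p v =
      ∫ y, h (y, γ y) * (v.2 - fderiv ℝ γ y v.1) := by
  refine tendsto_nhds_unique (tendsto_difference_quotient_integral_subgraph hγ hh hc v) ?_
  -- `β t` is the graph function of the region translated by `t • v`. The same difference quotient
  -- is now an integral over the layer between `γ` and `β t`, and the `t`-derivative of `β t y` at
  -- zero is `v.2 - fderiv ℝ γ y v.1`.
  set β : ℝ → E2 → ℝ := fun t y => γ (y - t • v.1) + t * v.2 with hβ
  have hγc := hγ.continuous
  have hβc : ∀ t, Continuous (β t) := fun t => by simp only [hβ]; fun_prop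
  have hQ : ∀ t : ℝ, t⁻¹ * ((∫ p in {p : E2 × ℝ | p.2 < γ p.1}, h (p + t • v)) -
      ∫ p in {p : E2 × ℝ | p.2 < γ p.1}, h p) =
      ∫ y, t⁻¹ * ∫ s in (γ y)..(β t y), h (y, s) := by
    intro t
    rw [setIntegral_subgraph_translate hγ.continuous, setIntegral_subgraph hh.continuous hc hγc]
    have := setIntegral_subgraph hh.continuous hc (hβc t)
    simp only [hβ] at this
    simp only [Prod.smul_fst, Prod.smul_snd, smul_eq_mul]
    rw [this, ← integral_sub (integrable_setIntegral_slice hh.continuous hc (hβc t))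
      (integrable_setIntegral_slice hh.continuous hc hγc), ← integral_const_mul]
    refine integral_congr_ae (Eventually.of_forall fun y => ?_)
    have hi := integrable_slice hh.continuous hc y
    simp only
    rw [← integral_Iic_eq_integral_Iio, ← integral_Iic_eq_integral_Iio,
      intervalIntegral.integral_Iic_sub_Iic hi.integrableOn hi.integrableOn]
  simp_rw [hQ]
  obtain ⟨M, hM⟩ := hc.exists_bound_of_continuous hh.continuous
  obtain ⟨R, hR⟩ := hc.isCompact.isBounded.subset_closedBall 0
  have hsupp : ∀ y s, y ∉ Metric.closedBall (0 : E2) R → h (y, s) = 0 := fun y s hy =>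
    image_eq_zero_of_notMem_tsupport fun hp' => hy (by
      have := hR hp'
      rw [mem_closedBall_zero_iff] at this ⊢
      exact (norm_fst_le (y, s)).trans this)
  have hM0 : 0 ≤ M := (norm_nonneg _).trans (hM 0)
  -- The layer has height at most `t * (K * ‖v.1‖ + |v.2|)` and `|h| ≤ M`; the factor `t` cancels
  -- against `t⁻¹`.
  refine tendsto_integral_filter_of_dominated_convergence
    ((Metric.closedBall (0 : E2) R).indicator fun _ => M * (K * ‖v.1‖ + |v.2|)) ?_ ?_ ?_ ?_
  · refine Eventually.of_forall fun t => ?_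
    have h1 := ((integrable_setIntegral_slice hh.continuous hc (hβc t)).sub
      (integrable_setIntegral_slice hh.continuous hc hγc)).aestronglyMeasurable.const_mul t⁻¹
    refine h1.congr (Eventually.of_forall fun y => ?_)
    have hi := integrable_slice hh.continuous hc y
    simp only [Pi.sub_apply]
    rw [← integral_Iic_eq_integral_Iio, ← integral_Iic_eq_integral_Iio,
      intervalIntegral.integral_Iic_sub_Iic hi.integrableOn hi.integrableOn]
  · filter_upwards [self_mem_nhdsWithin] with t ht
    have ht : 0 < t := ht
    refine Eventually.of_forall fun y => ?_
    by_cases hy : y ∈ Metric.closedBall (0 : E2) R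
    · rw [indicator_of_mem hy, norm_mul, norm_inv, Real.norm_of_nonneg ht.le]
      have h1 : ‖∫ s in (γ y)..(β t y), h (y, s)‖ ≤ M * |β t y - γ y| :=
        intervalIntegral.norm_integral_le_of_norm_le_const fun s _ => hM _
      have h2 : |β t y - γ y| ≤ t * (K * ‖v.1‖ + |v.2|) := by
        have h3 := hγ.norm_sub_le (y - t • v.1) y
        rw [sub_sub_cancel_left, norm_neg, norm_smul, Real.norm_of_nonneg ht.le,
          Real.norm_eq_abs] at h3
        calc |β t y - γ y| = |(γ (y - t • v.1) - γ y) + t * v.2| := by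
              simp only [hβ]; ring_nf
          _ ≤ |γ (y - t • v.1) - γ y| + |t * v.2| := abs_add_le _ _
          _ ≤ _ := by rw [abs_mul, abs_of_pos ht]; linarith
      rw [inv_mul_le_iff₀ ht]
      refine h1.trans ((mul_le_mul_of_nonneg_left h2 hM0).trans (le_of_eq ?_))
      ring
    · rw [indicator_of_notMem hy]
      simp [hsupp y _ hy]
  · refine (integrable_indicator_iff Metric.isClosed_closedBall.measurableSet).2
      (integrableOn_const measure_closedBall_lt_top.ne)
  · filter_upwards [hγ.ae_differentiableAt] with y hy
    have hsl : Continuous fun s => h (y, s) := hh.continuous.comp (Continuous.prodMk_right y)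
    have h1 : HasDerivAt (fun b => ∫ s in (γ y)..b, h (y, s)) (h (y, γ y)) (β 0 y) := by
      have : β 0 y = γ y := by simp [hβ]
      rw [this]
      exact intervalIntegral.integral_hasDerivAt_right (hsl.intervalIntegrable _ _)
        (hsl.stronglyMeasurableAtFilter _ _) hsl.continuousAt
    have h2 : HasDerivAt (fun t => β t y) (v.2 - fderiv ℝ γ y v.1) 0 := by
      have h3 : HasDerivAt (fun t : ℝ => y - t • v.1) (-v.1) 0 := by
        simpa using ((hasDerivAt_id (0 : ℝ)).smul_const v.1).const_sub y
      have h4 : HasFDerivAt γ (fderiv ℝ γ y) (y - (0 : ℝ) • v.1) := by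
        simpa using hy.hasFDerivAt
      have h5 := h4.comp_hasDerivAt (0 : ℝ) h3
      have h6 : HasDerivAt (fun t : ℝ => t * v.2) v.2 0 := by
        simpa using (hasDerivAt_id (0 : ℝ)).mul_const v.2
      have := h5.add h6
      rw [map_neg, neg_add_eq_sub] at this
      exact this
    have h7 := (h1.comp (0 : ℝ) h2).tendsto_slope_zero_right
    refine h7.congr fun t => ?_
    simp [hβ]

/-- The parametrization of space by chart coordinates. -/
noncomputable def chartEquiv (e : E3 ≃ₗᵢ[ℝ] WithLp 2 (E2 × ℝ)) : (E2 × ℝ) ≃L[ℝ] E3 :=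
  (WithLp.prodContinuousLinearEquiv 2 ℝ E2 ℝ).symm.trans e.symm.toContinuousLinearEquiv

theorem chartEquiv_apply (e : E3 ≃ₗᵢ[ℝ] WithLp 2 (E2 × ℝ)) (p : E2 × ℝ) :
    chartEquiv e p = e.symm (WithLp.toLp 2 p) := rfl

theorem measurePreserving_chartEquiv (e : E3 ≃ₗᵢ[ℝ] WithLp 2 (E2 × ℝ)) :
    MeasurePreserving (chartEquiv e) := by
  exact e.symm.measurePreserving.comp (WithLp.volume_preserving_toLp E2 ℝ)

theorem measurableEmbedding_chartEquiv (e : E3 ≃ₗᵢ[ℝ] WithLp 2 (E2 × ℝ)) :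
    MeasurableEmbedding (chartEquiv e) :=
  (chartEquiv e).toHomeomorph.measurableEmbedding

theorem inner_graphNormal (γ : E2 → ℝ) (y : E2) (w : WithLp 2 (E2 × ℝ)) :
    inner ℝ (graphNormal γ y) w = w.snd - fderiv ℝ γ y w.fst := by
  rw [graphNormal, WithLp.prod_inner_apply]
  simp only [inner_neg_left, gradient, toDual_symm_apply]
  simp; ring

/-- The downward shift `s` is carried along because it leaves `graphNormal γ` unchanged, and the
formula is needed below lowered graphs that stay inside `D`. -/
theorem setIntegral_chart_fderiv (e : E3 ≃ₗᵢ[ℝ] WithLp 2 (E2 × ℝ)) {γ : E2 → ℝ} {K : ℝ≥0}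
    (hγ : LipschitzWith K γ) (s : ℝ)
    {h : E3 → ℝ} (hh : ContDiff ℝ 1 h) (hc : HasCompactSupport h) (v : E3) :
    ∫ x in {x | (e x).snd < γ (e x).fst - s}, fderiv ℝ h x v =
      ∫ y, h (chartEquiv e (y, γ y - s)) * inner ℝ (graphNormal γ y) (e v) := by
  have hγs : LipschitzWith K fun y => γ y - s := by
    apply LipschitzWith.of_dist_le_mul
    intro x y
    simpa using hγ.dist_le_mul x y
  have key := setIntegral_subgraph_fderiv hγs (h := h ∘ chartEquiv e)
    (hh.comp (chartEquiv e).contDiff) (hc.comp_homeomorph (chartEquiv e).toHomeomorph)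
    (WithLp.ofLp (e v))
  rw [← (measurePreserving_chartEquiv e).setIntegral_preimage_emb
    (measurableEmbedding_chartEquiv e)]
  have hset : chartEquiv e ⁻¹' {x | (e x).snd < γ (e x).fst - s} =
      {p : E2 × ℝ | p.2 < γ p.1 - s} := by
    ext p; simp [chartEquiv_apply]
  have hd : ∀ p, fderiv ℝ (h ∘ chartEquiv e) p (WithLp.ofLp (e v)) =
      fderiv ℝ h (chartEquiv e p) v := by
    intro p
    rw [(chartEquiv e).comp_right_fderiv]
    simp [chartEquiv_apply]
  rw [hset]
  simp_rw [hd] at key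
  rw [key]
  refine integral_congr_ae (Eventually.of_forall fun y => ?_)
  simp only [inner_graphNormal, Function.comp_apply, fderiv_sub_const]
  rfl

/-! ### Boundary charts of a Lipschitz domain -/

/-- In the bounded open set `U`, the set `D` is the region below the graph of `γ` in the
coordinates `e`. -/
structure IsBoundaryChart (D : Set E3) (e : E3 ≃ₗᵢ[ℝ] WithLp 2 (E2 × ℝ)) (γ : E2 → ℝ) (K : ℝ≥0)
    (U : Set E3) : Prop where
  lipschitz : LipschitzWith K γ
  isOpen : IsOpen U
  isBounded : Bornology.IsBounded U
  mem_iff : ∀ x ∈ U, (x ∈ D ↔ (e x).snd < γ (e x).fst)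

theorem IsLipschitzDomain.exists_boundaryChart {D : Set E3} (hD : IsLipschitzDomain D) {p : E3}
    (hp : p ∈ frontier D) : ∃ e γ K U, IsBoundaryChart D e γ K U ∧ p ∈ U := by
  obtain ⟨e, γ, K, hγ, h⟩ := hD.locally_below_graph p hp
  obtain ⟨U, hU, hUo, hpU⟩ := eventually_nhds_iff.1 h
  exact ⟨e, γ, K, U ∩ Metric.ball p 1, ⟨hγ, hUo.inter Metric.isOpen_ball,
    Metric.isBounded_ball.subset inter_subset_right, fun x hx => hU x hx.1⟩, hpU, by simp⟩

theorem continuous_chart_fst (e : E3 ≃ₗᵢ[ℝ] WithLp 2 (E2 × ℝ)) : Continuous fun x => (e x).fst :=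
  continuous_fst.comp ((WithLp.prod_continuous_ofLp 2 _ _).comp e.continuous)

theorem continuous_chart_snd (e : E3 ≃ₗᵢ[ℝ] WithLp 2 (E2 × ℝ)) : Continuous fun x => (e x).snd :=
  continuous_snd.comp ((WithLp.prod_continuous_ofLp 2 _ _).comp e.continuous)

theorem norm_chart_fst_sub_le (e : E3 ≃ₗᵢ[ℝ] WithLp 2 (E2 × ℝ)) (x z : E3) :
    ‖(e x).fst - (e z).fst‖ ≤ ‖x - z‖ := by
  rw [← e.norm_map (x - z), map_sub]
  exact norm_le_norm_toLp _ _

theorem chartEquiv_chart (e : E3 ≃ₗᵢ[ℝ] WithLp 2 (E2 × ℝ)) (x : E3) :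
    chartEquiv e ((e x).fst, (e x).snd) = x :=
  e.symm_apply_apply x

theorem chart_chartEquiv (e : E3 ≃ₗᵢ[ℝ] WithLp 2 (E2 × ℝ)) (p : E2 × ℝ) :
    e (chartEquiv e p) = WithLp.toLp 2 p :=
  e.apply_symm_apply _

theorem continuous_chartEquiv_graph (e : E3 ≃ₗᵢ[ℝ] WithLp 2 (E2 × ℝ)) {γ : E2 → ℝ}
    (hγ : Continuous γ) : Continuous fun y => chartEquiv e (y, γ y) :=
  (chartEquiv e).continuous.comp (continuous_id.prodMk hγ)

theorem measurableEmbedding_chartEquiv_graph (e : E3 ≃ₗᵢ[ℝ] WithLp 2 (E2 × ℝ)) {γ : E2 → ℝ}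
    (hγ : Continuous γ) : MeasurableEmbedding fun y => chartEquiv e (y, γ y) := by
  refine (continuous_chartEquiv_graph e hγ).measurableEmbedding fun x y hxy => ?_
  exact congrArg Prod.fst ((chartEquiv e).injective hxy)

theorem norm_graphNormal_le {γ : E2 → ℝ} {K : ℝ≥0} (hγ : LipschitzWith K γ) (y : E2) :
    ‖graphNormal γ y‖ ≤ 1 + K := by
  refine le_of_sq_le_sq ?_ (by positivity)
  have h : ‖gradient γ y‖ ≤ K := by
    rw [gradient, LinearIsometryEquiv.norm_map]
    exact norm_fderiv_le_of_lipschitz ℝ hγ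
  have h2 : ‖gradient γ y‖ ^ 2 ≤ (K : ℝ) ^ 2 := by gcongr
  rw [graphNormal, norm_sq_toLp, norm_neg]
  nlinarith [K.coe_nonneg]

theorem one_le_norm_graphNormal (γ : E2 → ℝ) (y : E2) : 1 ≤ ‖graphNormal γ y‖ :=
  one_le_norm_toLp_one _

theorem norm_outwardNormal_le (D : Set E3) (x : E3) : ‖outwardNormal D x‖ ≤ 1 := by
  unfold outwardNormal
  split_ifs with h
  · exact h.choose_spec.1.le
  · simp

namespace IsBoundaryChart

variable {D : Set E3} {e : E3 ≃ₗᵢ[ℝ] WithLp 2 (E2 × ℝ)} {γ : E2 → ℝ} {K : ℝ≥0} {U : Set E3}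

/-- Points on the graph are limits of points vertically below them, which lie in `D`; conversely the
region on or below the graph is closed. -/
theorem mem_closure_iff (h : IsBoundaryChart D e γ K U) {x : E3} (hx : x ∈ U) :
    x ∈ closure D ↔ (e x).snd ≤ γ (e x).fst := by
  constructor
  · intro hxD
    have h1 : x ∈ closure (U ∩ D) := h.isOpen.inter_closure ⟨hx, hxD⟩
    have hcl : IsClosed {x : E3 | (e x).snd ≤ γ (e x).fst} :=
      isClosed_le (continuous_chart_snd e) (h.lipschitz.continuous.comp (continuous_chart_fst e))
    exact hcl.closure_subset_iff.2 (fun z hz => ((h.mem_iff z hz.1).1 hz.2).le) h1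
  · intro hle
    set c : ℝ → E3 := fun t => chartEquiv e ((e x).fst, (e x).snd - t) with hc
    have hcc : Continuous c := (chartEquiv e).continuous.comp (by fun_prop)
    have h0 : c 0 = x := by simp [hc, chartEquiv_chart]
    have hlim : Tendsto c (𝓝[>] 0) (𝓝 x) := by
      have := hcc.tendsto 0
      rw [h0] at this
      exact this.mono_left nhdsWithin_le_nhds
    refine mem_closure_of_tendsto hlim ?_
    filter_upwards [hlim.eventually (h.isOpen.mem_nhds hx), self_mem_nhdsWithin] with t ht ht0
    have ht0 : 0 < t := ht0
    rw [h.mem_iff _ ht]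
    simp only [hc, chart_chartEquiv, WithLp.toLp_fst, WithLp.toLp_snd]
    linarith

theorem mem_frontier_iff (h : IsBoundaryChart D e γ K U) (hD : IsOpen D) {x : E3} (hx : x ∈ U) :
    x ∈ frontier D ↔ (e x).snd = γ (e x).fst := by
  rw [hD.frontier_eq, Set.mem_sdiff, h.mem_closure_iff hx, h.mem_iff x hx, not_lt]
  exact ⟨fun h => le_antisymm h.1 h.2, fun h => ⟨h.le, h.ge⟩⟩

theorem frontier_inter (h : IsBoundaryChart D e γ K U) (hD : IsOpen D) :
    frontier D ∩ U = range (fun y => chartEquiv e (y, γ y)) ∩ U := by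
  ext x
  constructor
  · rintro ⟨hx, hU⟩
    refine ⟨⟨(e x).fst, ?_⟩, hU⟩
    simp only
    rw [← (h.mem_frontier_iff hD hU).1 hx, chartEquiv_chart]
  · rintro ⟨⟨y, rfl⟩, hU⟩
    refine ⟨(h.mem_frontier_iff hD hU).2 ?_, hU⟩
    simp only [chart_chartEquiv, WithLp.toLp_fst, WithLp.toLp_snd]

/-- Inside `U` the boundary is the graph, and the isometry `e` preserves Hausdorff measure, so the
area formula for graphs transfers. -/
theorem surfaceMeasure_restrict (h : IsBoundaryChart D e γ K U) (hD : IsOpen D) :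
    (surfaceMeasure D).restrict U =
      ((volume.withDensity fun y => ENNReal.ofReal ‖graphNormal γ y‖).map
        fun y => chartEquiv e (y, γ y)).restrict U := by
  have hU := h.isOpen.measurableSet
  have hgm := measurableEmbedding_graphMap h.lipschitz.continuous
  have h1 : (fun y => chartEquiv e (y, γ y)) = e.symm ∘ graphMap γ := rfl
  rw [surfaceMeasure, Measure.restrict_restrict hU, inter_comm, h.frontier_inter hD, inter_comm,
    ← Measure.restrict_restrict hU, h1,
    ← Measure.map_map e.symm.continuous.measurable hgm.measurable,
    ← restrict_range_graphMap h.lipschitz, range_comp]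
  have h2 := (e.symm.toIsometryEquiv.measurePreserving_euclideanHausdorffMeasure 2).map_eq
  have h3 : (e.symm.toIsometryEquiv : WithLp 2 (E2 × ℝ) → E3) = e.symm := rfl
  have h4 : e.symm '' range (graphMap γ) = e ⁻¹' range (graphMap γ) :=
    e.symm.toEquiv.image_eq_preimage_symm _
  rw [h3] at h2
  rw [h4]
  congr 1
  conv_lhs => rw [← h2]
  rw [Measure.restrict_map e.symm.continuous.measurable
    (e.continuous.measurable hgm.measurableSet_range)]
  congr 2
  ext z; simp

theorem integrableOn_iff {F : Type*} [NormedAddCommGroup F] [NormedSpace ℝ F]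
    (h : IsBoundaryChart D e γ K U) (hD : IsOpen D) {k : E3 → F} :
    IntegrableOn k U (surfaceMeasure D) ↔
      IntegrableOn (fun y => ‖graphNormal γ y‖ • k (chartEquiv e (y, γ y)))
        ((fun y => chartEquiv e (y, γ y)) ⁻¹' U) := by
  have hm : Measurable fun y => ENNReal.ofReal ‖graphNormal γ y‖ :=
    (measurable_graphNormal γ).norm.ennreal_ofReal
  have hemb := measurableEmbedding_chartEquiv_graph e h.lipschitz.continuous
  rw [IntegrableOn, h.surfaceMeasure_restrict hD, ← IntegrableOn, hemb.integrableOn_map_iff,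
    IntegrableOn, restrict_withDensity (hemb.measurable h.isOpen.measurableSet),
    integrable_withDensity_iff_integrable_smul' hm (by simp)]
  simp [IntegrableOn]

theorem setIntegral_eq {F : Type*} [NormedAddCommGroup F] [NormedSpace ℝ F]
    (h : IsBoundaryChart D e γ K U) (hD : IsOpen D) (k : E3 → F) :
    ∫ x in U, k x ∂surfaceMeasure D =
      ∫ y in (fun y => chartEquiv e (y, γ y)) ⁻¹' U,
        ‖graphNormal γ y‖ • k (chartEquiv e (y, γ y)) := by
  have hm : Measurable fun y => ENNReal.ofReal ‖graphNormal γ y‖ :=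
    (measurable_graphNormal γ).norm.ennreal_ofReal
  have hemb := measurableEmbedding_chartEquiv_graph e h.lipschitz.continuous
  rw [h.surfaceMeasure_restrict hD, hemb.setIntegral_map,
    restrict_withDensity (hemb.measurable h.isOpen.measurableSet),
    integral_withDensity_eq_integral_toReal_smul₀ hm.aemeasurable (by simp)]
  simp

/-- The normal component of `z - x` is the height of `z` above the tangent plane, divided by
`‖graphNormal γ y‖ ≥ 1`. Differentiability of `γ` makes the gap between graph and tangent plane
`o(‖z - x‖)`, and membership in `D` decides the side of the graph. -/
theorem isOutwardUnitNormal (h : IsBoundaryChart D e γ K U) {y : E2}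
    (hy : DifferentiableAt ℝ γ y) (hU : chartEquiv e (y, γ y) ∈ U) :
    IsOutwardUnitNormal D (chartEquiv e (y, γ y))
      (‖graphNormal γ y‖⁻¹ • e.symm (graphNormal γ y)) := by
  have hN := one_le_norm_graphNormal γ y
  have hN0 : 0 < ‖graphNormal γ y‖ := by linarith
  refine ⟨?_, fun ε hε => ?_⟩
  · rw [norm_smul, norm_inv, norm_norm, LinearIsometryEquiv.norm_map, inv_mul_cancel₀ hN0.ne']
  have hlim : Tendsto (fun z => (e z).fst) (𝓝 (chartEquiv e (y, γ y))) (𝓝 y) := by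
    have := (continuous_chart_fst e).tendsto (chartEquiv e (y, γ y))
    rwa [chart_chartEquiv] at this
  have hder := hlim.eventually ((hasFDerivAt_iff_isLittleO.1 hy.hasFDerivAt).def hε)
  filter_upwards [hder, h.isOpen.mem_nhds hU] with z hz hzU
  set x := chartEquiv e (y, γ y) with hx
  have hex : e x = WithLp.toLp 2 (y, γ y) := chart_chartEquiv _ _
  have h1 : inner ℝ (‖graphNormal γ y‖⁻¹ • e.symm (graphNormal γ y)) (z - x) =
      ‖graphNormal γ y‖⁻¹ * ((e z).snd - γ y - fderiv ℝ γ y ((e z).fst - y)) := by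
    rw [real_inner_smul_left, ← e.inner_map_map, e.apply_symm_apply, inner_graphNormal, map_sub,
      hex]
    rfl
  have h2 : ‖(e z).fst - y‖ ≤ ‖z - x‖ := by
    have := norm_chart_fst_sub_le e z x
    rwa [hex] at this
  have h3 : ε * ‖(e z).fst - y‖ ≤ ε * ‖z - x‖ := by gcongr
  have h4 : 0 ≤ ε * ‖z - x‖ := by positivity
  rw [Real.norm_eq_abs, abs_le] at hz
  rw [h1]
  constructor
  · intro hzD
    have := (h.mem_iff z hzU).1 hzD
    rw [inv_mul_le_iff₀ hN0]
    nlinarith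
  · intro hzD
    have := not_lt.1 (fun hlt => hzD ((h.mem_iff z hzU).2 hlt))
    rw [← div_eq_inv_mul, le_div_iff₀ hN0]
    nlinarith

/-- The area density is exactly the factor that removes the normalization, so fluxes in a chart
involve only `graphNormal`. -/
theorem outwardNormal_eq (h : IsBoundaryChart D e γ K U) {y : E2}
    (hy : DifferentiableAt ℝ γ y) (hU : chartEquiv e (y, γ y) ∈ U) :
    ‖graphNormal γ y‖ • outwardNormal D (chartEquiv e (y, γ y)) = e.symm (graphNormal γ y) := by
  have h1 := h.isOutwardUnitNormal hy hU
  have hex : ∃ ν, IsOutwardUnitNormal D (chartEquiv e (y, γ y)) ν := ⟨_, h1⟩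
  have hN0 : ‖graphNormal γ y‖ ≠ 0 := by linarith [one_le_norm_graphNormal γ y]
  rw [outwardNormal, dif_pos hex, hex.choose_spec.unique h1, smul_inv_smul₀ hN0]

/-- Near `p` the open downward cone of slope `K` with apex `p` lies in `D`, by the Lipschitz bound.
It is convex with nonempty interior. This makes the gradient on the closure unambiguous at boundary
points. -/
theorem uniqueDiffWithinAt (h : IsBoundaryChart D e γ K U) (hD : IsOpen D) {p : E3} (hp : p ∈ U)
    (hpD : p ∈ frontier D) : UniqueDiffWithinAt ℝ (closure D) p := by
  set C : Set E3 := {x | (e x).snd + K * ‖(e x).fst - (e p).fst‖ < (e p).snd} with hC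
  have hCo : IsOpen C := by
    have h1 := continuous_chart_fst e
    have h2 := continuous_chart_snd e
    exact isOpen_lt (by fun_prop) continuous_const
  have hCconv : Convex ℝ C := by
    have hf : IsLinearMap ℝ fun x => (e x).fst :=
      ⟨fun x y => by simp, fun c x => by simp⟩
    have hs : IsLinearMap ℝ fun x => (e x).snd :=
      ⟨fun x y => by simp, fun c x => by simp⟩
    intro x hx y hy a b ha hb hab
    simp only [hC, mem_ofPred_eq] at hx hy ⊢
    have e1 : (e (a • x + b • y)).snd = a * (e x).snd + b * (e y).snd := by simp
    have e2 : (e (a • x + b • y)).fst - (e p).fst =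
        a • ((e x).fst - (e p).fst) + b • ((e y).fst - (e p).fst) := by
      have : (e p).fst = (a + b) • (e p).fst := by rw [hab, one_smul]
      conv_lhs => rw [this]
      simp only [map_add, map_smul, WithLp.add_fst, WithLp.smul_fst]
      module
    have e3 : ‖(e (a • x + b • y)).fst - (e p).fst‖ ≤
        a * ‖(e x).fst - (e p).fst‖ + b * ‖(e y).fst - (e p).fst‖ := by
      rw [e2]
      refine (norm_add_le _ _).trans ?_
      rw [norm_smul, norm_smul, Real.norm_of_nonneg ha, Real.norm_of_nonneg hb]
    have e4 := mul_le_mul_of_nonneg_left e3 K.coe_nonneg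
    rw [e1]
    have e5 : a * ((e x).snd + K * ‖(e x).fst - (e p).fst‖) +
        b * ((e y).snd + K * ‖(e y).fst - (e p).fst‖) < a * (e p).snd + b * (e p).snd := by
      rcases ha.eq_or_lt with rfl | ha'
      · have : b = 1 := by linarith
        subst this; linarith
      · have := mul_lt_mul_of_pos_left hx ha'
        have := mul_le_mul_of_nonneg_left hy.le hb
        linarith
    have e6 : a * (e p).snd + b * (e p).snd = (e p).snd := by rw [← add_mul, hab, one_mul]
    linarith
  have hmem : ∀ t : ℝ, 0 < t → chartEquiv e ((e p).fst, (e p).snd - t) ∈ C := by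
    intro t ht
    simp [hC, chart_chartEquiv, ht]
  have hpC : p ∈ closure C := by
    have hcc : Continuous fun t : ℝ => chartEquiv e ((e p).fst, (e p).snd - t) :=
      (chartEquiv e).continuous.comp (by fun_prop)
    have hlim := (hcc.tendsto 0).mono_left (nhdsWithin_le_nhds (s := Ioi 0))
    rw [sub_zero, chartEquiv_chart] at hlim
    refine mem_closure_of_tendsto hlim ?_
    filter_upwards [self_mem_nhdsWithin] with t ht using hmem t ht
  have hu : UniqueDiffWithinAt ℝ C p := by
    refine uniqueDiffWithinAt_convex hCconv ?_ hpC
    rw [hCo.interior_eq]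
    exact ⟨_, hmem 1 one_pos⟩
  refine (hu.inter (h.isOpen.mem_nhds hp)).mono fun x hx => subset_closure ?_
  rw [h.mem_iff x hx.2]
  have h1 : (e p).snd = γ (e p).fst := (h.mem_frontier_iff hD hp).1 hpD
  have h2 := h.lipschitz.norm_sub_le (e x).fst (e p).fst
  rw [Real.norm_eq_abs, abs_le] at h2
  have h3 : (e x).snd + K * ‖(e x).fst - (e p).fst‖ < (e p).snd := hx.1
  linarith

theorem isBounded_preimage (h : IsBoundaryChart D e γ K U) :
    Bornology.IsBounded ((fun y => chartEquiv e (y, γ y)) ⁻¹' U) := by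
  obtain ⟨R, hR⟩ := h.isBounded.subset_closedBall 0
  refine (Metric.isBounded_closedBall (x := (0 : E2)) (r := R)).subset fun y hy => ?_
  have h1 := hR hy
  rw [mem_closedBall_zero_iff] at h1 ⊢
  have h2 := norm_chart_fst_sub_le e (chartEquiv e (y, γ y)) 0
  rw [chart_chartEquiv] at h2
  simp only [map_zero, WithLp.zero_fst, sub_zero] at h2
  exact h2.trans h1

end IsBoundaryChart

/-! ### Integrability over the boundary surface -/

theorem integrableOn_inv_norm_ball (R : ℝ) :
    IntegrableOn (fun y : E2 => ‖y‖⁻¹) (Metric.ball 0 R) := by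
  have h1 : (Metric.ball (0 : E2) R).indicator (fun y : E2 => ‖y‖⁻¹) =
      fun y => (Iio R).indicator (fun r : ℝ => r⁻¹) ‖y‖ := by
    ext y
    simp [indicator]
  -- In polar coordinates of the plane the Jacobian `r` cancels `r⁻¹`.
  rw [← integrable_indicator_iff Metric.isOpen_ball.measurableSet, h1,
    integrable_fun_norm_addHaar volume (f := (Iio R).indicator (fun r : ℝ => r⁻¹))]
  have h2 : IntegrableOn (fun _ : ℝ => (1 : ℝ)) (Ioo 0 R) := integrableOn_const (by simp)
  rw [← integrable_indicator_iff measurableSet_Ioo] at h2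
  refine (h2.integrableOn (s := Ioi 0)).congr_fun ?_ measurableSet_Ioi
  intro r hr
  have hr : (0 : ℝ) < r := hr
  by_cases hrR : r < R <;> simp [indicator, hr, hrR, hr.ne']

theorem integrableOn_inv_norm_sub {s : Set E2} (hs : Bornology.IsBounded s) (z : E2) :
    IntegrableOn (fun y : E2 => ‖y - z‖⁻¹) s := by
  obtain ⟨R, hR⟩ := hs.subset_ball z
  refine IntegrableOn.mono_set ?_ hR
  have h := (integrableOn_inv_norm_ball R)
  rw [← integrable_indicator_iff Metric.isOpen_ball.measurableSet] at h ⊢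
  refine (h.comp_sub_right z).congr (Eventually.of_forall fun y => ?_)
  simp [indicator, dist_eq_norm]

theorem IsLipschitzDomain.uniqueDiffOn_closure {D : Set E3} (hD : IsLipschitzDomain D) :
    UniqueDiffOn ℝ (closure D) := by
  intro x hx
  by_cases hxD : x ∈ D
  · exact ((hD.isOpen.uniqueDiffWithinAt hxD)).mono subset_closure
  · have hxf : x ∈ frontier D := by rw [hD.isOpen.frontier_eq]; exact ⟨hx, hxD⟩
    obtain ⟨e, γ, K, U, h, hU⟩ := hD.exists_boundaryChart hxf
    exact h.uniqueDiffWithinAt hD.isOpen hU hxf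

theorem IsLipschitzDomain.isCompact_closure {D : Set E3} (hD : IsLipschitzDomain D) :
    IsCompact (closure D) :=
  hD.isBounded.isCompact_closure

theorem IsLipschitzDomain.isCompact_frontier {D : Set E3} (hD : IsLipschitzDomain D) :
    IsCompact (frontier D) :=
  hD.isCompact_closure.of_isClosed_subset isClosed_frontier frontier_subset_closure

/-- The boundary is compact and covered by charts, so local integrability suffices. -/
theorem IsLipschitzDomain.integrable_of_charts {F : Type*} [NormedAddCommGroup F]
    {D : Set E3} (hD : IsLipschitzDomain D) {k : E3 → F}
    (hk : ∀ e γ K U, IsBoundaryChart D e γ K U → IntegrableOn k U (surfaceMeasure D)) :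
    Integrable k (surfaceMeasure D) := by
  have h1 : IntegrableOn k (frontier D) (surfaceMeasure D) := by
    refine LocallyIntegrableOn.integrableOn_isCompact (fun p hp => ?_) hD.isCompact_frontier
    obtain ⟨e, γ, K, U, h, hU⟩ := hD.exists_boundaryChart hp
    exact ⟨U, mem_nhdsWithin_of_mem_nhds (h.isOpen.mem_nhds hU), hk _ _ _ _ h⟩
  rwa [IntegrableOn, surfaceMeasure, Measure.restrict_restrict isClosed_frontier.measurableSet,
    inter_self] at h1

theorem IsLipschitzDomain.isFiniteMeasure {D : Set E3} (hD : IsLipschitzDomain D) :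
    IsFiniteMeasure (surfaceMeasure D) := by
  have : Integrable (fun _ => (1 : ℝ)) (surfaceMeasure D) := by
    refine hD.integrable_of_charts fun e γ K U h => ?_
    rw [h.integrableOn_iff hD.isOpen]
    refine Measure.integrableOn_of_bounded (M := 1 + K) h.isBounded_preimage.measure_lt_top.ne
      ?_ (Eventually.of_forall fun y => ?_)
    · exact ((measurable_graphNormal γ).norm.smul_const _).aestronglyMeasurable
    · simpa using norm_graphNormal_le h.lipschitz y
  exact (integrable_const_iff_isFiniteMeasure one_ne_zero).1 this

/-- In a chart the distance to `x₀` is at least the horizontal distance, which reduces the claim to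
the planar kernel `‖y - z‖⁻¹` with a density at most `1 + K`. This function dominates every surface
limit in the representation formula. -/
theorem IsLipschitzDomain.integrable_inv_norm_sub {D : Set E3} (hD : IsLipschitzDomain D)
    (x₀ : E3) : Integrable (fun x => ‖x - x₀‖⁻¹) (surfaceMeasure D) := by
  refine hD.integrable_of_charts fun e γ K U h => ?_
  rw [h.integrableOn_iff hD.isOpen]
  have hc := continuous_chartEquiv_graph e h.lipschitz.continuous
  refine ((integrableOn_inv_norm_sub h.isBounded_preimage (e x₀).fst).const_mul (1 + K)).mono'
    ?_ ?_
  · exact ((measurable_graphNormal γ).norm.smul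
      (hc.measurable.sub_const x₀).norm.inv).aestronglyMeasurable
  · have hne : ∀ᵐ y : E2, y ≠ (e x₀).fst := by
      rw [ae_iff]; simp
    refine ae_restrict_of_ae ?_
    filter_upwards [hne] with y hy
    have h2 := norm_chart_fst_sub_le e (chartEquiv e (y, γ y)) x₀
    rw [chart_chartEquiv] at h2
    rw [smul_eq_mul, norm_mul, norm_norm, norm_inv, norm_norm]
    have h3 : 0 < ‖y - (e x₀).fst‖ := norm_pos_iff.2 (sub_ne_zero.2 hy)
    exact mul_le_mul (norm_graphNormal_le h.lipschitz y) (inv_anti₀ h3 h2) (by positivity)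
      (by positivity)

/-- `outwardNormal` is defined by choice; its measurability comes from its almost everywhere
agreement, in charts, with the normalized `graphNormal`. -/
theorem IsLipschitzDomain.integrable_outwardNormal {D : Set E3} (hD : IsLipschitzDomain D) :
    Integrable (outwardNormal D) (surfaceMeasure D) := by
  refine hD.integrable_of_charts fun e γ K U h => ?_
  rw [h.integrableOn_iff hD.isOpen]
  have hc := continuous_chartEquiv_graph e h.lipschitz.continuous
  have h1 : IntegrableOn (fun y => e.symm (graphNormal γ y))
      ((fun y => chartEquiv e (y, γ y)) ⁻¹' U) := by
    refine Measure.integrableOn_of_bounded (M := 1 + K) h.isBounded_preimage.measure_lt_top.ne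
      ?_ (Eventually.of_forall fun y => ?_)
    · exact (e.symm.continuous.measurable.comp (measurable_graphNormal γ)).aestronglyMeasurable
    · rw [LinearIsometryEquiv.norm_map]
      exact norm_graphNormal_le h.lipschitz y
  refine h1.congr ?_
  rw [Filter.EventuallyEq, ae_restrict_iff' (hc.measurable h.isOpen.measurableSet)]
  filter_upwards [h.lipschitz.ae_differentiableAt] with y hy hU
  exact (h.outwardNormal_eq hy hU).symm

theorem surfaceMeasure_singleton (D : Set E3) (x : E3) : surfaceMeasure D {x} = 0 := by
  have h1 : Measure.euclideanHausdorffMeasure 2 ({x} : Set E3) = 0 := by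
    rw [Measure.euclideanHausdorffMeasure_def, Measure.smul_apply]
    have := Measure.nullSingletonClass_hausdorff E3 (d := ((2 : ℕ) : ℝ)) (by norm_num)
    rw [measure_singleton, smul_zero]
  exact le_antisymm ((Measure.restrict_apply_le _ _).trans h1.le) bot_le

/-! ### The divergence theorem on a Lipschitz domain -/

/-- The divergence of a vector field in space. -/
noncomputable def divergence (F : E3 → E3) (x : E3) : ℝ :=
  ∑ i : Fin 3, (fderiv ℝ F x (EuclideanSpace.single i 1)) i

theorem divergence_congr {F G : E3 → E3} {x : E3} (h : F =ᶠ[𝓝 x] G) :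
    divergence F x = divergence G x := by
  simp only [divergence, h.fderiv_eq]

theorem measurable_divergence (F : E3 → E3) : Measurable (divergence F) := by
  refine Finset.measurable_fun_sum _ fun i _ => ?_
  exact (EuclideanSpace.proj (𝕜 := ℝ) i).continuous.measurable.comp (measurable_fderiv_apply_const ℝ F _)

theorem sum_smul_single (v : E3) :
    ∑ i : Fin 3, v i • (EuclideanSpace.single i (1 : ℝ) : E3) = v := by
  ext j
  simp [Finset.sum_apply, Pi.single_apply]

theorem divergence_smul {χ : E3 → ℝ} {F : E3 → E3} {x : E3} (hχ : DifferentiableAt ℝ χ x)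
    (hF : DifferentiableAt ℝ F x) :
    divergence (fun z => χ z • F z) x = χ x * divergence F x + fderiv ℝ χ x (F x) := by
  have h1 : fderiv ℝ χ x (F x) =
      ∑ i : Fin 3, F x i * fderiv ℝ χ x (EuclideanSpace.single i 1) := by
    conv_lhs => rw [← sum_smul_single (F x)]
    simp only [map_sum, map_smul, smul_eq_mul]
  rw [h1, divergence, divergence, Finset.mul_sum, ← Finset.sum_add_distrib]
  refine Finset.sum_congr rfl fun i _ => ?_
  rw [fderiv_fun_smul hχ hF]
  simp [mul_comm]

theorem divergence_eq_zero_of_notMem_tsupport {F : E3 → E3} {x : E3} (hx : x ∉ tsupport F) :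
    divergence F x = 0 := by
  simp [divergence, fderiv_of_notMem_tsupport ℝ hx]

theorem fderiv_component {F : E3 → E3} {x : E3} (hF : DifferentiableAt ℝ F x) (i : Fin 3)
    (v : E3) : fderiv ℝ (fun z => F z i) x v = (fderiv ℝ F x v) i := by
  have := ((EuclideanSpace.proj (𝕜 := ℝ) i).hasFDerivAt.comp x hF.hasFDerivAt).fderiv
  have h2 : (fun z => F z i) = (EuclideanSpace.proj (𝕜 := ℝ) i) ∘ F := rfl
  rw [h2, this]
  rfl

theorem contDiff_component {F : E3 → E3} (hF : ContDiff ℝ 1 F) (i : Fin 3) :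
    ContDiff ℝ 1 fun z => F z i :=
  (EuclideanSpace.proj (𝕜 := ℝ) i).contDiff.comp hF

theorem hasCompactSupport_component {F : E3 → E3} (hF : HasCompactSupport F) (i : Fin 3) :
    HasCompactSupport fun z => F z i :=
  hF.comp_left (g := fun v : E3 => v i) rfl

theorem integrable_fderiv_component {F : E3 → E3} (hF : ContDiff ℝ 1 F) (hc : HasCompactSupport F)
    (i : Fin 3) (v : E3) : Integrable fun x => fderiv ℝ (fun z => F z i) x v := by
  refine Continuous.integrable_of_hasCompactSupport ?_ ?_
  · exact ((contDiff_component hF i).continuous_fderiv one_ne_zero).clm_apply continuous_const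
  · exact (hasCompactSupport_component hc i).fderiv_apply ℝ v

theorem divergence_eq_sum_component {F : E3 → E3} (hF : ContDiff ℝ 1 F) (x : E3) :
    divergence F x = ∑ i : Fin 3, fderiv ℝ (fun z => F z i) x (EuclideanSpace.single i 1) :=
  Finset.sum_congr rfl fun i _ =>
    (fderiv_component ((hF.differentiable one_ne_zero) x) i _).symm

/-- The divergence of a compactly supported field has zero integral. -/
theorem integral_divergence_eq_zero {F : E3 → E3} (hF : ContDiff ℝ 1 F)
    (hc : HasCompactSupport F) : ∫ x, divergence F x = 0 := by
  simp_rw [divergence_eq_sum_component hF]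
  rw [integral_finsetSum _ fun i _ => integrable_fderiv_component hF hc i _]
  refine Finset.sum_eq_zero fun i _ => ?_
  have hi := contDiff_component hF i
  have h1 := integrable_fderiv_component hF hc i (EuclideanSpace.single i 1)
  have h2 : Integrable fun z => F z i :=
    hi.continuous.integrable_of_hasCompactSupport (hasCompactSupport_component hc i)
  have h := integral_mul_fderiv_eq_neg_fderiv_mul_of_integrable (μ := (volume : Measure E3))
    (f := fun _ : E3 => (1 : ℝ)) (g := fun z => F z i) (v := EuclideanSpace.single i 1)
    (by simp) (by simpa using h1) (by simpa using h2) (fun _ _ => differentiableAt_const _)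
    (fun x _ => hi.differentiable one_ne_zero x)
  simpa using h

theorem setIntegral_chart_divergence (e : E3 ≃ₗᵢ[ℝ] WithLp 2 (E2 × ℝ)) {γ : E2 → ℝ} {K : ℝ≥0}
    (hγ : LipschitzWith K γ) (s : ℝ) {F : E3 → E3} (hF : ContDiff ℝ 1 F)
    (hc : HasCompactSupport F) :
    ∫ x in {x | (e x).snd < γ (e x).fst - s}, divergence F x =
      ∫ y, inner ℝ (F (chartEquiv e (y, γ y - s))) (e.symm (graphNormal γ y)) := by
  simp_rw [divergence_eq_sum_component hF]
  rw [integral_finsetSum _ fun i _ => (integrable_fderiv_component hF hc i _).integrableOn]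
  have hN : ∀ (i : Fin 3) y, inner ℝ (graphNormal γ y) (e (EuclideanSpace.single i (1 : ℝ))) =
      (e.symm (graphNormal γ y)) i := by
    intro i y
    rw [← e.symm.inner_map_map, e.symm_apply_apply, EuclideanSpace.inner_single_right]
    simp
  have hcont : Continuous fun y => chartEquiv e (y, γ y - s) :=
    (chartEquiv e).continuous.comp (continuous_id.prodMk (hγ.continuous.sub continuous_const))
  have hint : ∀ i : Fin 3, Integrable fun y =>
      F (chartEquiv e (y, γ y - s)) i *
        inner ℝ (graphNormal γ y) (e (EuclideanSpace.single i (1 : ℝ))) := by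
    intro i
    have h1 : Integrable fun y => F (chartEquiv e (y, γ y - s)) i := by
      refine ((contDiff_component hF i).continuous.comp hcont).integrable_of_hasCompactSupport ?_
      refine (hasCompactSupport_component hc i).comp_isClosedEmbedding ?_
      refine (chartEquiv e).toHomeomorph.isClosedEmbedding.comp ?_
      have hcs : Continuous fun y : E2 => (y, γ y - s) :=
        continuous_id.prodMk (hγ.continuous.sub continuous_const)
      exact Function.LeftInverse.isClosedEmbedding (f := Prod.fst) (fun _ => rfl)
        continuous_fst hcs
    refine h1.mul_bdd (c := 1 + K) ?_ (Eventually.of_forall fun y => ?_)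
    · exact ((measurable_graphNormal γ).inner measurable_const).aestronglyMeasurable
    · refine (norm_inner_le_norm _ _).trans ?_
      rw [LinearIsometryEquiv.norm_map]
      simpa using norm_graphNormal_le hγ y
  rw [Finset.sum_congr rfl fun i _ => setIntegral_chart_fderiv e hγ s (contDiff_component hF i)
    (hasCompactSupport_component hc i) _, ← integral_finsetSum _ fun i _ => hint i]
  refine integral_congr_ae (Eventually.of_forall fun y => ?_)
  simp only [hN, PiLp.inner_apply]
  simp [mul_comm]

/-- Outside `D` the cutoff vanishes in a neighbourhood, so regularity of `F` in `D` alone is enough.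
-/
theorem contDiff_smul_of_tsupport_subset {D : Set E3} (hD : IsOpen D) {χ : E3 → ℝ}
    (hχ : ContDiff ℝ 1 χ) (hs : tsupport χ ⊆ D) {F : E3 → E3} (hF : ContDiffOn ℝ 1 F D) :
    ContDiff ℝ 1 fun x => χ x • F x := by
  refine contDiff_iff_contDiffAt.2 fun x => ?_
  by_cases hx : x ∈ D
  · exact hχ.contDiffAt.smul (hF.contDiffAt (hD.mem_nhds hx))
  · have h0 : χ =ᶠ[𝓝 x] 0 := notMem_tsupport_iff_eventuallyEq.1 fun h => hx (hs h)
    refine (contDiffAt_const (c := (0 : E3))).congr_of_eventuallyEq ?_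
    filter_upwards [h0] with z hz
    simp [hz]

theorem hasCompactSupport_smul {χ : E3 → ℝ} (hc : HasCompactSupport χ) (F : E3 → E3) :
    HasCompactSupport fun x => χ x • F x :=
  hc.mono' (fun x hx => subset_tsupport χ fun h => hx (by simp [h]))

theorem tsupport_smul_field_subset (χ : E3 → ℝ) (F : E3 → E3) :
    tsupport (fun x => χ x • F x) ⊆ tsupport χ :=
  tsupport_smul_subset_left χ F

theorem exists_contDiff_cutoff {K V : Set E3} (hK : IsCompact K) (hV : IsOpen V) (hKV : K ⊆ V) :
    ∃ η : E3 → ℝ, ContDiff ℝ 1 η ∧ HasCompactSupport η ∧ tsupport η ⊆ V ∧ ∀ x ∈ K, η x = 1 := by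
  obtain ⟨W, hWo, hKW, hWV, hWc⟩ := exists_open_between_and_isCompact_closure hK hV hKV
  obtain ⟨η, hη, -, hsupp, h1⟩ :=
    exists_contMDiff_support_eq_eq_one_iff (n := 1) 𝓘(ℝ, E3) hWo hK.isClosed hKW
  have hts : tsupport η = closure W := by rw [tsupport, hsupp]
  refine ⟨η, contMDiff_iff_contDiff.1 hη, ?_, hts ▸ hWV, fun x hx => (h1 x).1 hx⟩
  rw [HasCompactSupport, hts]
  exact hWc

/-! ### The divergence theorem in one boundary chart -/

namespace IsBoundaryChart

variable {D : Set E3} {e : E3 ≃ₗᵢ[ℝ] WithLp 2 (E2 × ℝ)} {γ : E2 → ℝ} {K : ℝ≥0} {U : Set E3}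

/-- The field is `C¹` only inside `D`. A second cutoff `η`, supported in `D` and equal to one on the
part of `tsupport χ` lying at least `s / 2` below the graph, makes it `C¹` on all of space. -/
theorem setIntegral_divergence_below (h : IsBoundaryChart D e γ K U) (hD : IsOpen D) {χ : E3 → ℝ}
    (hχ : ContDiff ℝ 1 χ) (hc : HasCompactSupport χ) (hs : tsupport χ ⊆ U) {F : E3 → E3}
    (hF : ContDiffOn ℝ 1 F D) {s : ℝ} (hs0 : 0 < s) :
    ∫ x in {x | (e x).snd < γ (e x).fst - s}, divergence (fun z => χ z • F z) x =
      ∫ y, inner ℝ (χ (chartEquiv e (y, γ y - s)) • F (chartEquiv e (y, γ y - s)))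
        (e.symm (graphNormal γ y)) := by
  have hc1 := continuous_chart_fst e
  have hc2 := continuous_chart_snd e
  have hγ := h.lipschitz.continuous
  -- Half the shift leaves an open margin: the cut-off field agrees with the original near every
  -- point of the region and on its bounding graph, so divergence and flux are unchanged.
  have hKc : IsCompact ({x | (e x).snd ≤ γ (e x).fst - s / 2} ∩ tsupport χ) :=
    hc.isCompact.inter_left (isClosed_le hc2 ((hγ.comp hc1).sub continuous_const))
  have hKD : {x | (e x).snd ≤ γ (e x).fst - s / 2} ∩ tsupport χ ⊆ D ∩ U := by
    rintro x ⟨hx1, hx2⟩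
    have hx1 : (e x).snd ≤ γ (e x).fst - s / 2 := hx1
    exact ⟨(h.mem_iff x (hs hx2)).2 (by linarith), hs hx2⟩
  obtain ⟨η, hη, hηc, hηs, hη1⟩ := exists_contDiff_cutoff hKc (hD.inter h.isOpen) hKD
  have hHd : ContDiff ℝ 1 fun x => η x • (χ x • F x) :=
    contDiff_smul_of_tsupport_subset hD hη (hηs.trans inter_subset_left)
      (hχ.contDiffOn.smul hF)
  have heq : ∀ x ∈ {x | (e x).snd < γ (e x).fst - s / 2}, η x • (χ x • F x) = χ x • F x := by
    intro x hx
    have hx : (e x).snd < γ (e x).fst - s / 2 := hx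
    by_cases hxt : x ∈ tsupport χ
    · rw [hη1 x ⟨hx.le, hxt⟩, one_smul]
    · simp [image_eq_zero_of_notMem_tsupport hxt]
  have hOo : IsOpen {x | (e x).snd < γ (e x).fst - s / 2} :=
    isOpen_lt hc2 ((hγ.comp hc1).sub continuous_const)
  have hOm : MeasurableSet {x | (e x).snd < γ (e x).fst - s} :=
    (isOpen_lt hc2 ((hγ.comp hc1).sub continuous_const)).measurableSet
  have key := setIntegral_chart_divergence e h.lipschitz s hHd (hasCompactSupport_smul hηc _)
  rw [setIntegral_congr_fun (g := fun x => divergence (fun z => η z • (χ z • F z)) x) hOm, key]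
  · refine integral_congr_ae (Eventually.of_forall fun y => ?_)
    simp only
    rw [heq]
    simp only [mem_ofPred_eq, chart_chartEquiv, WithLp.toLp_fst, WithLp.toLp_snd]
    linarith
  · intro x hx
    have hx : (e x).snd < γ (e x).fst - s := hx
    refine divergence_congr ?_
    have hxO : x ∈ {x | (e x).snd < γ (e x).fst - s / 2} := by
      simp only [mem_ofPred_eq]; linarith
    filter_upwards [hOo.mem_nhds hxO] with z hz
    exact (heq z hz).symm

/-- Inside `U` the lowered regions increase to `D` as `s` decreases to zero, and outside `U` the
divergence vanishes; `|divergence H|` on `D` dominates. -/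
theorem tendsto_setIntegral_divergence (h : IsBoundaryChart D e γ K U) (hD : IsOpen D)
    {H : E3 → E3} (hs : tsupport H ⊆ U) (hi : IntegrableOn (divergence H) D) :
    Tendsto (fun s => ∫ x in {x | (e x).snd < γ (e x).fst - s}, divergence H x) (𝓝[>] 0)
      (𝓝 (∫ x in D, divergence H x)) := by
  have hc1 := continuous_chart_fst e
  have hc2 := continuous_chart_snd e
  have hγ := h.lipschitz.continuous
  have hOm : ∀ s : ℝ, MeasurableSet {x | (e x).snd < γ (e x).fst - s} := fun s =>
    (isOpen_lt hc2 ((hγ.comp hc1).sub continuous_const)).measurableSet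
  have hz : ∀ x, x ∉ U → divergence H x = 0 := fun x hx =>
    divergence_eq_zero_of_notMem_tsupport fun hx' => hx (hs hx')
  rw [← integral_indicator hD.measurableSet]
  simp_rw [← integral_indicator (hOm _)]
  refine tendsto_integral_filter_of_dominated_convergence
    (D.indicator fun x => ‖divergence H x‖) ?_ ?_ ?_ ?_
  · exact Eventually.of_forall fun s =>
      ((measurable_divergence H).indicator (hOm s)).aestronglyMeasurable
  · filter_upwards [self_mem_nhdsWithin] with s hs0
    have hs0 : 0 < s := hs0
    refine Eventually.of_forall fun x => ?_
    by_cases hxU : x ∈ U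
    · by_cases hxD : x ∈ D
      · rw [indicator_of_mem hxD]
        exact norm_indicator_le_norm_self _ _
      · have hx : x ∉ {x | (e x).snd < γ (e x).fst - s} := fun hx => by
          have hx : (e x).snd < γ (e x).fst - s := hx
          exact hxD ((h.mem_iff x hxU).2 (by linarith))
        simp [hxD, indicator_of_notMem hx]
    · simp [indicator, hz x hxU]
  · exact (integrable_indicator_iff hD.measurableSet).2 hi.norm
  · refine Eventually.of_forall fun x => ?_
    by_cases hxU : x ∈ U
    · by_cases hxD : x ∈ D
      · have hlt := (h.mem_iff x hxU).1 hxD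
        refine tendsto_const_nhds.congr' ?_
        have hpos : 0 < γ (e x).fst - (e x).snd := by linarith
        filter_upwards [Ioo_mem_nhdsGT hpos] with s hs0
        have hx : x ∈ {x | (e x).snd < γ (e x).fst - s} := by
          simp only [mem_ofPred_eq]; linarith [hs0.2]
        rw [indicator_of_mem hxD, indicator_of_mem hx]
      · refine tendsto_const_nhds.congr' ?_
        filter_upwards [self_mem_nhdsWithin] with s hs0
        have hs0 : 0 < s := hs0
        have hx : x ∉ {x | (e x).snd < γ (e x).fst - s} := fun hx => by
          have hx : (e x).snd < γ (e x).fst - s := hx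
          exact hxD ((h.mem_iff x hxU).2 (by linarith))
        rw [indicator_of_notMem hxD, indicator_of_notMem hx]
    · simp [indicator, hz x hxU]

/-- Only continuity of `F` up to the boundary is used: points of the lowered graphs in `U` lie in
the closure of `D` and converge vertically to the graph. -/
theorem tendsto_integral_below (h : IsBoundaryChart D e γ K U)
    {χ : E3 → ℝ} (hχ : Continuous χ) (hc : HasCompactSupport χ) (hs : tsupport χ ⊆ U)
    {F : E3 → E3} (hFm : Measurable F) {M : ℝ} (hM0 : 0 ≤ M) (hM : ∀ x ∈ closure D, ‖χ x • F x‖ ≤ M)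
    (hF : ContinuousOn F (closure D)) :
    Tendsto (fun s => ∫ y, inner ℝ
        (χ (chartEquiv e (y, γ y - s)) • F (chartEquiv e (y, γ y - s)))
        (e.symm (graphNormal γ y))) (𝓝[>] 0)
      (𝓝 (∫ y, inner ℝ (χ (chartEquiv e (y, γ y)) • F (chartEquiv e (y, γ y)))
        (e.symm (graphNormal γ y)))) := by
  have hγ := h.lipschitz.continuous
  have hcont : ∀ s, Continuous fun y => chartEquiv e (y, γ y - s) := fun s =>
    (chartEquiv e).continuous.comp (continuous_id.prodMk (hγ.sub continuous_const))
  obtain ⟨R, hR⟩ := hc.isCompact.isBounded.subset_closedBall 0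
  have hcl : ∀ y s, 0 ≤ s → chartEquiv e (y, γ y - s) ∈ U →
      chartEquiv e (y, γ y - s) ∈ closure D := by
    intro y s hs0 hU
    rw [h.mem_closure_iff hU]
    simp only [chart_chartEquiv, WithLp.toLp_fst, WithLp.toLp_snd]
    linarith
  have hzero : ∀ x, x ∉ tsupport χ → χ x • F x = 0 := fun x hx => by
    simp [image_eq_zero_of_notMem_tsupport hx]
  refine tendsto_integral_filter_of_dominated_convergence
    ((Metric.closedBall (0 : E2) R).indicator fun _ => M * (1 + K)) ?_ ?_ ?_ ?_
  · refine Eventually.of_forall fun s => Measurable.aestronglyMeasurable ?_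
    exact ((hχ.measurable.comp (hcont s).measurable).smul
      (hFm.comp (hcont s).measurable)).inner
      (e.symm.continuous.measurable.comp (measurable_graphNormal γ))
  · filter_upwards [self_mem_nhdsWithin] with s hs0
    have hs0 : 0 < s := hs0
    refine Eventually.of_forall fun y => ?_
    by_cases hx : chartEquiv e (y, γ y - s) ∈ tsupport χ
    · have hy : y ∈ Metric.closedBall (0 : E2) R := by
        have h1 := hR hx
        rw [mem_closedBall_zero_iff] at h1 ⊢
        have h2 := norm_chart_fst_sub_le e (chartEquiv e (y, γ y - s)) 0
        rw [chart_chartEquiv] at h2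
        simp only [map_zero, WithLp.zero_fst, sub_zero] at h2
        exact h2.trans h1
      rw [indicator_of_mem hy]
      refine (norm_inner_le_norm _ _).trans ?_
      rw [LinearIsometryEquiv.norm_map]
      have h1 := hM _ (hcl y s hs0.le (hs hx))
      exact mul_le_mul h1 (norm_graphNormal_le h.lipschitz y) (norm_nonneg _)
        ((norm_nonneg _).trans h1)
    · rw [hzero _ hx, inner_zero_left, norm_zero]
      exact indicator_nonneg (fun _ _ => mul_nonneg hM0 (by positivity)) _
  · exact (integrable_indicator_iff Metric.isClosed_closedBall.measurableSet).2
      (integrableOn_const measure_closedBall_lt_top.ne)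
  · refine Eventually.of_forall fun y => ?_
    have hlim : Tendsto (fun s => chartEquiv e (y, γ y - s)) (𝓝[>] 0)
        (𝓝 (chartEquiv e (y, γ y))) := by
      have hcs : Continuous fun s : ℝ => chartEquiv e (y, γ y - s) :=
        (chartEquiv e).continuous.comp (by fun_prop)
      have := hcs.tendsto 0
      rw [sub_zero] at this
      exact this.mono_left nhdsWithin_le_nhds
    refine Tendsto.inner ?_ tendsto_const_nhds
    by_cases hx : chartEquiv e (y, γ y) ∈ U
    · have hxD : chartEquiv e (y, γ y) ∈ closure D := by
        have := hcl y 0 le_rfl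
        rw [sub_zero] at this
        exact this hx
      refine ((hχ.tendsto _).comp hlim).smul ((hF _ hxD).tendsto.comp ?_)
      refine tendsto_nhdsWithin_iff.2 ⟨hlim, ?_⟩
      filter_upwards [hlim.eventually (h.isOpen.mem_nhds hx), self_mem_nhdsWithin] with s hsU hs0
      exact hcl y s (le_of_lt hs0) hsU
    · have hx' : chartEquiv e (y, γ y) ∉ tsupport χ := fun hh => hx (hs hh)
      rw [hzero _ hx']
      refine tendsto_const_nhds.congr' ?_
      filter_upwards [hlim.eventually ((isClosed_tsupport χ).isOpen_compl.mem_nhds hx')] with s hs1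
      exact (hzero _ hs1).symm

theorem integral_flux_eq (h : IsBoundaryChart D e γ K U) (hD : IsOpen D) {H : E3 → E3}
    (hH : ∀ x, x ∉ U → H x = 0) :
    ∫ y, inner ℝ (H (chartEquiv e (y, γ y))) (e.symm (graphNormal γ y)) =
      ∫ x, inner ℝ (H x) (outwardNormal D x) ∂surfaceMeasure D := by
  have hUm : MeasurableSet ((fun y => chartEquiv e (y, γ y)) ⁻¹' U) :=
    (measurableEmbedding_chartEquiv_graph e h.lipschitz.continuous).measurable
      h.isOpen.measurableSet
  rw [← setIntegral_eq_integral_of_forall_compl_eq_zero (s := U)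
    (fun x hx => by rw [hH x hx, inner_zero_left]), h.setIntegral_eq hD,
    ← setIntegral_eq_integral_of_forall_compl_eq_zero
      (s := (fun y => chartEquiv e (y, γ y)) ⁻¹' U)
    (fun y hy => by rw [hH _ hy, inner_zero_left])]
  refine setIntegral_congr_ae hUm ?_
  filter_upwards [h.lipschitz.ae_differentiableAt] with y hy hU
  rw [← h.outwardNormal_eq hy hU, inner_smul_right, smul_eq_mul]

/-- The divergence theorem for a field supported in a boundary chart. -/
theorem setIntegral_divergence (h : IsBoundaryChart D e γ K U) (hD : IsOpen D) {χ : E3 → ℝ}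
    (hχ : ContDiff ℝ 1 χ) (hc : HasCompactSupport χ) (hs : tsupport χ ⊆ U) {F : E3 → E3}
    (hFm : Measurable F) {M : ℝ} (hM0 : 0 ≤ M) (hM : ∀ x ∈ closure D, ‖χ x • F x‖ ≤ M)
    (hF : ContinuousOn F (closure D)) (hFd : ContDiffOn ℝ 1 F D)
    (hi : IntegrableOn (divergence fun z => χ z • F z) D) :
    ∫ x in D, divergence (fun z => χ z • F z) x =
      ∫ x, inner ℝ (χ x • F x) (outwardNormal D x) ∂surfaceMeasure D := by
  have h1 := h.tendsto_setIntegral_divergence hD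
    ((tsupport_smul_field_subset χ F).trans hs) hi
  have h2 := h.tendsto_integral_below hχ.continuous hc hs hFm hM0 hM hF
  rw [h.integral_flux_eq hD (H := fun x => χ x • F x) fun x hx => by
    simp [image_eq_zero_of_notMem_tsupport fun hh => hx (hs hh)]] at h2
  refine tendsto_nhds_unique h1 (h2.congr' ?_)
  filter_upwards [self_mem_nhdsWithin] with s hs0
  exact (h.setIntegral_divergence_below hD hχ hc hs hFd hs0).symm

end IsBoundaryChart

/-! ### Globalization by a partition of unity -/

theorem IsLipschitzDomain.integrable_flux {D : Set E3} (hD : IsLipschitzDomain D) {F : E3 → E3}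
    (hF : ContinuousOn F (closure D)) :
    Integrable (fun x => inner ℝ (F x) (outwardNormal D x)) (surfaceMeasure D) := by
  have := hD.isFiniteMeasure
  obtain ⟨M, hM⟩ := hD.isCompact_closure.exists_bound_of_continuousOn hF
  have hFf : ContinuousOn F (frontier D) := hF.mono frontier_subset_closure
  have hmeas : AEStronglyMeasurable F (surfaceMeasure D) :=
    hFf.aestronglyMeasurable isClosed_frontier.measurableSet
  refine Integrable.of_bound (hmeas.inner hD.integrable_outwardNormal.aestronglyMeasurable) M ?_
  rw [surfaceMeasure, ae_restrict_iff' isClosed_frontier.measurableSet]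
  refine Eventually.of_forall fun x hx => (norm_inner_le_norm _ _).trans ?_
  have h1 := hM x (frontier_subset_closure hx)
  have h2 := norm_outwardNormal_le D x
  nlinarith [norm_nonneg (F x), norm_nonneg (outwardNormal D x)]

theorem setIntegral_surface_congr {D : Set E3} {f g : E3 → ℝ} (h : ∀ x ∈ frontier D, f x = g x) :
    ∫ x, f x ∂surfaceMeasure D = ∫ x, g x ∂surfaceMeasure D :=
  setIntegral_congr_fun isClosed_frontier.measurableSet h

theorem IsLipschitzDomain.exists_partition {D : Set E3} (hD : IsLipschitzDomain D) :
    ∃ (ι : Type) (_ : Fintype ι) (χ : ι → E3 → ℝ), (∀ i, ContDiff ℝ 1 (χ i)) ∧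
      (∀ i, HasCompactSupport (χ i)) ∧ (∀ x ∈ closure D, ∑ i, χ i x = 1) ∧
      ∀ i, tsupport (χ i) ⊆ D ∨
        ∃ e γ K U, IsBoundaryChart D e γ K U ∧ tsupport (χ i) ⊆ U := by
  -- Points off the boundary are assigned `D` itself; for those outside the closure this is a mere
  -- default, hence the implication.
  have hloc : ∀ x : E3, ∃ U : Set E3, IsOpen U ∧ Bornology.IsBounded U ∧ (x ∈ closure D → x ∈ U) ∧
      (U = D ∨ ∃ e γ K, IsBoundaryChart D e γ K U) := by
    intro x
    by_cases hx : x ∈ frontier D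
    · obtain ⟨e, γ, K, U, h, hU⟩ := hD.exists_boundaryChart hx
      exact ⟨U, h.isOpen, h.isBounded, fun _ => hU, Or.inr ⟨e, γ, K, h⟩⟩
    · refine ⟨D, hD.isOpen, hD.isBounded, fun hxc => ?_, Or.inl rfl⟩
      by_contra hxD
      exact hx (by rw [hD.isOpen.frontier_eq]; exact ⟨hxc, hxD⟩)
  choose U hUo hUb hxU hU using hloc
  obtain ⟨t, -, ht⟩ := hD.isCompact_closure.elim_nhds_subcover U
    fun x hx => (hUo x).mem_nhds (hxU x hx)
  obtain ⟨f, hf⟩ := SmoothPartitionOfUnity.exists_isSubordinate 𝓘(ℝ, E3)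
    (isClosed_closure (s := D)) (fun i : t => U i) (fun i => hUo i) (by
      refine ht.trans (iUnion₂_subset fun i hi => ?_)
      exact subset_iUnion (fun i : t => U i) ⟨i, hi⟩)
  refine ⟨t, inferInstance, fun i => f i, fun i => ?_, fun i => ?_, fun x hx => ?_, fun i => ?_⟩
  · exact (contMDiff_iff_contDiff.1 (f i).contMDiff).of_le (by exact_mod_cast le_top)
  · exact Metric.isCompact_of_isClosed_isBounded (isClosed_tsupport _) ((hUb i).subset (hf i))
  · rw [← finsum_eq_sum_of_fintype]
    exact f.sum_eq_one hx
  · rcases hU i with h | ⟨e, γ, K, h⟩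
    · left
      have : tsupport (f i) ⊆ U i := hf i
      rwa [h] at this
    · exact Or.inr ⟨e, γ, K, U i, h, hf i⟩

/-- Pieces supported in `D` contribute zero on both sides, the others are handled in a chart.
Measurability on all of space is required because the chart integrals also evaluate `F` outside the
closure. -/
theorem IsLipschitzDomain.setIntegral_divergence_of_measurable {D : Set E3}
    (hD : IsLipschitzDomain D) {F : E3 → E3} (hFm : Measurable F)
    (hF : ContinuousOn F (closure D)) (hFd : ContDiffOn ℝ 1 F D)
    (hi : IntegrableOn (divergence F) D) :
    ∫ x in D, divergence F x = ∫ x, inner ℝ (F x) (outwardNormal D x) ∂surfaceMeasure D := by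
  obtain ⟨ι, _, χ, hχ, hc, hsum, hsub⟩ := hD.exists_partition
  have hDm := hD.isOpen.measurableSet
  have hFx : ∀ x ∈ D, DifferentiableAt ℝ F x := fun x hx =>
    (hFd.contDiffAt (hD.isOpen.mem_nhds hx)).differentiableAt one_ne_zero
  have hχx : ∀ i x, DifferentiableAt ℝ (χ i) x := fun i x => (hχ i).differentiable one_ne_zero x
  have hdiv : ∀ i, ∀ x ∈ D, divergence (fun z => χ i z • F z) x =
      χ i x * divergence F x + fderiv ℝ (χ i) x (F x) := fun i x hx =>
    divergence_smul (hχx i x) (hFx x hx)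
  obtain ⟨M, hM⟩ := hD.isCompact_closure.exists_bound_of_continuousOn hF
  have hint : ∀ i, IntegrableOn (divergence fun z => χ i z • F z) D := by
    intro i
    refine IntegrableOn.congr_fun ?_ (fun x hx => (hdiv i x hx).symm) hDm
    obtain ⟨C, hC⟩ := (hc i).exists_bound_of_continuous (hχ i).continuous
    obtain ⟨C', hC'⟩ := ((hc i).fderiv ℝ).exists_bound_of_continuous
      ((hχ i).continuous_fderiv one_ne_zero)
    refine Integrable.add ?_ ?_
    · exact hi.bdd_mul (hχ i).continuous.aestronglyMeasurable (Eventually.of_forall hC)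
    · refine Measure.integrableOn_of_bounded (M := C' * M) hD.isBounded.measure_lt_top.ne ?_ ?_
      · exact ContinuousLinearMap.aestronglyMeasurable_comp₂
          (ContinuousLinearMap.apply ℝ ℝ).flip
          ((hχ i).continuous_fderiv one_ne_zero).aestronglyMeasurable
          hFm.aestronglyMeasurable
      · refine (ae_restrict_iff' hDm).2 (Eventually.of_forall fun x hx => ?_)
        refine ((fderiv ℝ (χ i) x).le_opNorm _).trans ?_
        exact mul_le_mul (hC' x) (hM x (subset_closure hx)) (norm_nonneg _)
          ((norm_nonneg _).trans (hC' x))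
  have hlocal : ∀ i, ∫ x in D, divergence (fun z => χ i z • F z) x =
      ∫ x, inner ℝ (χ i x • F x) (outwardNormal D x) ∂surfaceMeasure D := by
    intro i
    rcases hsub i with hs | ⟨e, γ, K, U, h, hs⟩
    · rw [setIntegral_eq_integral_of_forall_compl_eq_zero fun x hx =>
        divergence_eq_zero_of_notMem_tsupport
          fun hh => hx (hs (tsupport_smul_field_subset (χ i) F hh)),
        integral_divergence_eq_zero (contDiff_smul_of_tsupport_subset hD.isOpen (hχ i) hs hFd)
          (hasCompactSupport_smul (hc i) F), setIntegral_surface_congr (g := fun _ => 0)]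
      · simp
      · intro x hx
        have hxD : x ∉ D := by rw [hD.isOpen.frontier_eq] at hx; exact hx.2
        rw [image_eq_zero_of_notMem_tsupport fun hh => hxD (hs hh), zero_smul, inner_zero_left]
    · obtain ⟨M', hM'⟩ := hD.isCompact_closure.exists_bound_of_continuousOn
        ((hχ i).continuous.continuousOn.smul hF)
      exact h.setIntegral_divergence hD.isOpen (hχ i) (hc i) hs hFm (abs_nonneg M')
        (fun x hx => (hM' x hx).trans (le_abs_self _)) hF hFd (hint i)
  have e1 : ∫ x in D, divergence F x = ∑ i, ∫ x in D, divergence (fun z => χ i z • F z) x := by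
    rw [← integral_finsetSum _ fun i _ => hint i]
    refine setIntegral_congr_fun hDm fun x hx => ?_
    -- The cutoffs sum to one near `x`, so their derivatives sum to zero and the terms `fderiv ℝ (χ
    -- i) x (F x)` cancel.
    have hone : (fun z => ∑ i, χ i z) =ᶠ[𝓝 x] fun _ => 1 := by
      filter_upwards [hD.isOpen.mem_nhds hx] with z hz using hsum z (subset_closure hz)
    have h0 : ∑ i, fderiv ℝ (χ i) x = 0 := by
      rw [← fderiv_fun_sum fun i _ => hχx i x, hone.fderiv_eq]
      simp
    rw [Finset.sum_congr rfl fun i _ => hdiv i x hx, Finset.sum_add_distrib, ← Finset.sum_mul,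
      hsum x (subset_closure hx), ← _root_.sum_apply, h0]
    simp
  have e2 : ∫ x, inner ℝ (F x) (outwardNormal D x) ∂surfaceMeasure D =
      ∑ i, ∫ x, inner ℝ (χ i x • F x) (outwardNormal D x) ∂surfaceMeasure D := by
    have hfl : ∀ i, Integrable (fun x => inner ℝ (χ i x • F x) (outwardNormal D x))
        (surfaceMeasure D) := fun i =>
      hD.integrable_flux ((hχ i).continuous.continuousOn.smul hF)
    rw [← integral_finsetSum _ fun i _ => hfl i]
    refine setIntegral_surface_congr fun x hx => ?_
    rw [← sum_inner, ← Finset.sum_smul, hsum x (frontier_subset_closure hx), one_smul]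
  rw [e1, e2]
  exact Finset.sum_congr rfl fun i _ => hlocal i

/-- The divergence theorem on a bounded Lipschitz domain. -/
theorem IsLipschitzDomain.setIntegral_divergence {D : Set E3} (hD : IsLipschitzDomain D)
    {F : E3 → E3} (hF : ContinuousOn F (closure D)) (hFd : ContDiffOn ℝ 1 F D)
    (hi : IntegrableOn (divergence F) D) :
    ∫ x in D, divergence F x = ∫ x, inner ℝ (F x) (outwardNormal D x) ∂surfaceMeasure D := by
  have hDm := hD.isOpen.measurableSet
  -- Only values on the closure matter; extension by zero makes the field Borel measurable.
  set G := (closure D).indicator F with hG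
  have hGF : EqOn G F (closure D) := fun x hx => indicator_of_mem hx F
  have hGm : Measurable G := by
    classical
    have := hF.measurable_piecewise (g := (0 : E3 → E3)) continuousOn_const
      isClosed_closure.measurableSet
    rwa [piecewise_eq_indicator] at this
  have hdiv : EqOn (divergence G) (divergence F) D := fun x hx =>
    divergence_congr (by
      filter_upwards [hD.isOpen.mem_nhds hx] with z hz using hGF (subset_closure hz))
  have key := hD.setIntegral_divergence_of_measurable hGm (hF.congr hGF)
    (hFd.congr fun x hx => hGF (subset_closure hx)) (hi.congr_fun hdiv.symm hDm)
  rw [setIntegral_congr_fun hDm hdiv] at key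
  rw [key]
  refine setIntegral_surface_congr fun x hx => ?_
  rw [hGF (frontier_subset_closure hx)]

/-! ### Green's second identity -/

theorem IsHarmonicC1.continuousOn {D : Set E3} {u : E3 → ℝ} (hu : IsHarmonicC1 D u) :
    ContinuousOn u (closure D) :=
  hu.contDiffOn.continuousOn

theorem IsHarmonicC1.continuousOn_gradientWithin {D : Set E3} {u : E3 → ℝ}
    (hu : IsHarmonicC1 D u) (hD : IsLipschitzDomain D) :
    ContinuousOn (gradientWithin u (closure D)) (closure D) :=
  (toDual ℝ E3).symm.continuous.comp_continuousOn
    (hu.contDiffOn.continuousOn_fderivWithin hD.uniqueDiffOn_closure le_rfl)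

theorem gradientWithin_closure_eq {D : Set E3} (hD : IsOpen D) (u : E3 → ℝ) {x : E3}
    (hx : x ∈ D) : gradientWithin u (closure D) x = gradient u x := by
  rw [gradientWithin, gradient,
    fderivWithin_of_mem_nhds (mem_of_superset (hD.mem_nhds hx) subset_closure)]

theorem gradientWithin_closure_eventuallyEq {D : Set E3} (hD : IsOpen D) (u : E3 → ℝ) {x : E3}
    (hx : x ∈ D) : gradientWithin u (closure D) =ᶠ[𝓝 x] gradient u := by
  filter_upwards [hD.mem_nhds hx] with z hz using gradientWithin_closure_eq hD u hz

theorem contDiffAt_gradient {u : E3 → ℝ} {x : E3} (hu : ContDiffAt ℝ 2 u x) :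
    ContDiffAt ℝ 1 (gradient u) x :=
  (toDual ℝ E3).symm.contDiff.contDiffAt.comp x (hu.fderiv_right (by norm_num))

theorem gradient_component (u : E3 → ℝ) (x : E3) (i : Fin 3) :
    gradient u x i = fderiv ℝ u x (EuclideanSpace.single i 1) := by
  have : inner ℝ (gradient u x) (EuclideanSpace.single i (1 : ℝ)) =
      fderiv ℝ u x (EuclideanSpace.single i 1) := by rw [gradient, toDual_symm_apply]
  rw [← this, EuclideanSpace.inner_single_right]
  simp

theorem divergence_gradient {u : E3 → ℝ} {x : E3} (hu : ContDiffAt ℝ 2 u x) :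
    divergence (gradient u) x = Laplacian.laplacian u x := by
  rw [laplacian_eq_iteratedFDeriv_orthonormalBasis u (EuclideanSpace.basisFun (Fin 3) ℝ)]
  refine Finset.sum_congr rfl fun i _ => ?_
  have hd : DifferentiableAt ℝ (fderiv ℝ u) x :=
    (hu.fderiv_right (m := 1) (by norm_num)).differentiableAt one_ne_zero
  rw [← fderiv_component ((contDiffAt_gradient hu).differentiableAt one_ne_zero),
    iteratedFDeriv_two_apply]
  simp_rw [gradient_component]
  rw [fderiv_clm_apply hd (differentiableAt_const _)]
  simp

theorem IsHarmonicC1.divergence_gradientWithin {D : Set E3} {u : E3 → ℝ} (hu : IsHarmonicC1 D u)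
    (hD : IsOpen D) {x : E3} (hx : x ∈ D) :
    divergence (gradientWithin u (closure D)) x = 0 := by
  rw [divergence_congr (gradientWithin_closure_eventuallyEq hD u hx),
    divergence_gradient (hu.harmonic x hx).1, (hu.harmonic x hx).2.self_of_nhds]
  rfl

theorem IsHarmonicC1.contDiffOn_gradientWithin {D : Set E3} {u : E3 → ℝ} (hu : IsHarmonicC1 D u)
    (hD : IsOpen D) : ContDiffOn ℝ 1 (gradientWithin u (closure D)) D := fun x hx =>
  ((contDiffAt_gradient (hu.harmonic x hx).1).congr_of_eventuallyEq
    (gradientWithin_closure_eventuallyEq hD u hx)).contDiffWithinAt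

theorem divergence_sub {F G : E3 → E3} {x : E3} (hF : DifferentiableAt ℝ F x)
    (hG : DifferentiableAt ℝ G x) :
    divergence (fun z => F z - G z) x = divergence F x - divergence G x := by
  rw [divergence, fderiv_fun_sub hF hG]
  simp [divergence, Finset.sum_sub_distrib]

/-- Green's second identity for a harmonic function and a smooth function `v` with gradient
field `w`. -/
theorem IsHarmonicC1.green {D : Set E3} {u : E3 → ℝ} (hu : IsHarmonicC1 D u)
    (hD : IsLipschitzDomain D) {v : E3 → ℝ} {w : E3 → E3} (hw : ContDiff ℝ 1 w)
    (hv : ContDiff ℝ 1 v) (hvw : ∀ x, HasGradientAt v (w x) x) :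
    ∫ x in D, u x * -divergence w x =
      ∫ x, (normalDeriv D u x * v x - u x * inner ℝ (w x) (outwardNormal D x))
        ∂surfaceMeasure D := by
  have hDm := hD.isOpen.measurableSet
  set g := gradientWithin u (closure D) with hg
  have hgc := hu.continuousOn_gradientWithin hD
  have hgd := hu.contDiffOn_gradientWithin hD.isOpen
  have hud : ContDiffOn ℝ 1 u D := hu.contDiffOn.mono subset_closure
  -- The two products of gradients cancel and `u` is harmonic, which leaves only `-u * divergence
  -- w`.
  have hdiv : EqOn (divergence fun x => v x • g x - u x • w x) (fun x => u x * -divergence w x) D := by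
    intro x hx
    have hnx := hD.isOpen.mem_nhds hx
    have hvx : DifferentiableAt ℝ v x := hv.differentiable one_ne_zero x
    have hwx : DifferentiableAt ℝ w x := hw.differentiable one_ne_zero x
    have hgx : DifferentiableAt ℝ g x := (hgd.contDiffAt hnx).differentiableAt one_ne_zero
    have hux : DifferentiableAt ℝ u x := (hud.contDiffAt hnx).differentiableAt one_ne_zero
    have e1 : fderiv ℝ v x (g x) = inner ℝ (w x) (g x) := by
      rw [(hvw x).hasFDerivAt.fderiv, toDual_apply_apply]
    have e2 : fderiv ℝ u x (w x) = inner ℝ (g x) (w x) := by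
      rw [hg, gradientWithin_closure_eq hD.isOpen u hx, gradient, toDual_symm_apply]
    have hvg : DifferentiableAt ℝ (fun z => v z • g z) x := hvx.smul hgx
    have huw : DifferentiableAt ℝ (fun z => u z • w z) x := hux.smul hwx
    rw [divergence_sub hvg huw, divergence_smul hvx hgx,
      divergence_smul hux hwx, hu.divergence_gradientWithin hD.isOpen hx, e1, e2,
      real_inner_comm (w x)]
    ring
  have hcw : Continuous (divergence w) :=
    continuous_finsetSum _ fun i _ => (EuclideanSpace.proj (𝕜 := ℝ) i).continuous.comp
      ((hw.continuous_fderiv one_ne_zero).clm_apply continuous_const)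
  -- Second derivatives of `u` may be unbounded near the boundary, but they have dropped out, and
  -- what remains is continuous on a compact set.
  have hint : IntegrableOn (fun x => u x * -divergence w x) D := by
    have : IntegrableOn (fun x => u x * -divergence w x) (closure D) :=
      (hu.continuousOn.mul hcw.neg.continuousOn).integrableOn_compact hD.isCompact_closure
    exact this.mono_set subset_closure
  have key := hD.setIntegral_divergence (F := fun x => v x • g x - u x • w x)
    ((hv.continuous.continuousOn.smul hgc).sub (hu.continuousOn.smul hw.continuous.continuousOn))
    ((hv.contDiffOn.smul hgd).sub (hud.smul hw.contDiffOn))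
    (hint.congr_fun hdiv.symm hDm)
  rw [setIntegral_congr_fun hDm hdiv] at key
  rw [key]
  refine setIntegral_surface_congr fun x hx => ?_
  rw [inner_sub_left, real_inner_smul_left, real_inner_smul_left, normalDeriv, ← hg, mul_comm]

/-! ### The regularized Newtonian kernel -/

/-- The regularized distance `√(|x - y|² + δ²)`. -/
noncomputable def regDist (δ : ℝ) (y x : E3) : ℝ := √(‖x - y‖ ^ 2 + δ ^ 2)

/-- The gradient of the inverse of the regularized distance. -/
noncomputable def regGrad (δ : ℝ) (y x : E3) : E3 := (-(regDist δ y x ^ 3)⁻¹) • (x - y)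

theorem regDist_pos {δ : ℝ} (hδ : 0 < δ) (y x : E3) : 0 < regDist δ y x :=
  Real.sqrt_pos.2 (by positivity)

theorem regDist_sq (δ : ℝ) (y x : E3) : regDist δ y x ^ 2 = ‖x - y‖ ^ 2 + δ ^ 2 :=
  Real.sq_sqrt (by positivity)

theorem norm_sub_le_regDist (δ : ℝ) (y x : E3) : ‖x - y‖ ≤ regDist δ y x :=
  Real.le_sqrt_of_sq_le (by nlinarith [sq_nonneg δ])

theorem contDiff_regDist {δ : ℝ} (hδ : 0 < δ) (y : E3) : ContDiff ℝ 1 (regDist δ y) := by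
  refine ContDiff.sqrt ?_ fun x => by positivity
  exact ((contDiff_id.sub contDiff_const).norm_sq ℝ).add contDiff_const

/-- The hypothesis `0 < regDist δ y x`, instead of `0 < δ`, also admits `δ = 0` at `x ≠ y`, hence
the unregularized distance. -/
theorem hasGradientAt_regDist {δ : ℝ} {y x : E3} (hpos : 0 < regDist δ y x) :
    HasGradientAt (regDist δ y) ((regDist δ y x)⁻¹ • (x - y)) x := by
  have h1 : HasFDerivAt (fun z : E3 => ‖z - y‖ ^ 2 + δ ^ 2) (2 • innerSL ℝ (x - y)) x := by
    have := (((hasFDerivAt_id x).sub_const y).norm_sq).add_const (δ ^ 2)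
    simpa using this
  have h2 := h1.sqrt (Real.sqrt_pos.1 hpos).ne'
  rw [hasGradientAt_iff_hasFDerivAt]
  refine h2.congr_fderiv ?_
  ext v
  change _ = inner ℝ _ v
  rw [real_inner_smul_left]
  change 1 / (2 * regDist δ y x) * (2 • inner ℝ (x - y) v) = _
  rw [nsmul_eq_mul]
  push_cast
  field_simp

theorem hasGradientAt_inv_regDist {δ : ℝ} {y x : E3} (hpos : 0 < regDist δ y x) :
    HasGradientAt (fun z => (regDist δ y z)⁻¹) (regGrad δ y x) x := by
  have h1 := (hasGradientAt_regDist hpos).hasFDerivAt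
  have h2 := (hasDerivAt_inv hpos.ne').comp_hasFDerivAt x h1
  rw [hasGradientAt_iff_hasFDerivAt]
  refine h2.congr_fderiv ?_
  ext v
  change -(regDist δ y x ^ 2)⁻¹ * inner ℝ _ v = inner ℝ _ v
  rw [regGrad, real_inner_smul_left, real_inner_smul_left]
  field_simp

theorem contDiff_regGrad {δ : ℝ} (hδ : 0 < δ) (y : E3) : ContDiff ℝ 1 (regGrad δ y) := by
  have h1 : ContDiff ℝ 1 fun x => (regDist δ y x ^ 3)⁻¹ :=
    ((contDiff_regDist hδ y).pow 3).inv fun x => (pow_pos (regDist_pos hδ y x) 3).ne'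
  have h2 : ContDiff ℝ 1 fun x : E3 => x - y := contDiff_id.sub contDiff_const
  exact h1.neg.smul h2

/-- With `ρ = regDist δ y x` the product rule gives `-3/ρ³ + 3‖x - y‖²/ρ⁵`, and `‖x - y‖² = ρ² -
δ²`. -/
theorem divergence_regGrad {δ : ℝ} (hδ : 0 < δ) (y x : E3) :
    divergence (regGrad δ y) x = -(3 * δ ^ 2 / regDist δ y x ^ 5) := by
  have hpos := regDist_pos hδ y x
  have h1 := (hasGradientAt_regDist hpos).hasFDerivAt
  have h2 : HasDerivAt (fun r : ℝ => -(r ^ 3)⁻¹) (3 * (regDist δ y x ^ 4)⁻¹) (regDist δ y x) := by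
    have h := ((hasDerivAt_pow 3 (regDist δ y x)).inv (pow_pos hpos 3).ne').neg
    refine h.congr_deriv ?_
    field_simp
    norm_num
    ring
  have h3 := h2.comp_hasFDerivAt x h1
  have hd : divergence (fun z => z - y) x = 3 := by
    simp [divergence, fderiv_sub_const]
  have key := divergence_smul (χ := (fun r : ℝ => -(r ^ 3)⁻¹) ∘ regDist δ y) (F := fun z => z - y)
    h3.differentiableAt (by fun_prop : DifferentiableAt ℝ (fun z : E3 => z - y) x)
  have e : (fun z => ((fun r : ℝ => -(r ^ 3)⁻¹) ∘ regDist δ y) z • (z - y)) = regGrad δ y := rfl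
  rw [e, h3.fderiv, hd] at key
  rw [key]
  change -(regDist δ y x ^ 3)⁻¹ * 3 + 3 * (regDist δ y x ^ 4)⁻¹ *
    inner ℝ ((regDist δ y x)⁻¹ • (x - y)) (x - y) = _
  rw [real_inner_smul_left, real_inner_self_eq_norm_sq]
  have h4 : ‖x - y‖ ^ 2 = regDist δ y x ^ 2 - δ ^ 2 := by rw [regDist_sq]; ring
  rw [h4]
  field_simp
  ring

/-! ### The regularized point source -/

/-- An antiderivative is `(r / √(1 + r²))³ / 3`, which tends to `1/3`. -/
theorem integral_Ioi_sq_div_sqrt_pow :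
    ∫ r in Ioi (0 : ℝ), r ^ 2 * ((√(1 + r ^ 2) ^ 5)⁻¹) = 1 / 3 := by
  have hs : ∀ r : ℝ, 0 < √(1 + r ^ 2) := fun r => Real.sqrt_pos.2 (by positivity)
  have hsq : ∀ r : ℝ, √(1 + r ^ 2) ^ 2 = 1 + r ^ 2 := fun r => Real.sq_sqrt (by positivity)
  have hder : ∀ r : ℝ, HasDerivAt (fun r => (1 / 3) * (r / √(1 + r ^ 2)) ^ 3)
      (r ^ 2 * ((√(1 + r ^ 2) ^ 5)⁻¹)) r := by
    intro r
    have h1 : HasDerivAt (fun r : ℝ => 1 + r ^ 2) (2 * r) r := by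
      simpa using (hasDerivAt_pow 2 r).const_add 1
    have h2 := h1.sqrt (by positivity : 1 + r ^ 2 ≠ 0)
    have h3 := (((hasDerivAt_id r).div h2 (hs r).ne').pow 3).const_mul (1 / 3)
    refine h3.congr_deriv ?_
    have h4 := hs r
    have h5 := hsq r
    simp only [id, Pi.div_apply]
    generalize √(1 + r ^ 2) = s at h4 h5
    have h6 : 1 * s - r * (2 * r / (2 * s)) = s⁻¹ := by
      field_simp
      linarith
    rw [h6]
    norm_num
    field_simp
  have hlim : Tendsto (fun r : ℝ => (1 / 3) * (r / √(1 + r ^ 2)) ^ 3) atTop (𝓝 (1 / 3)) := by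
    have h1 : Tendsto (fun r : ℝ => (√(1 + (r⁻¹) ^ 2))⁻¹) atTop (𝓝 1) := by
      have hc : Continuous fun t : ℝ => (√(1 + t ^ 2))⁻¹ :=
        (Real.continuous_sqrt.comp (by fun_prop)).inv₀ fun t => (hs t).ne'
      have := (hc.tendsto 0).comp tendsto_inv_atTop_zero
      simpa [Function.comp_def] using this
    have h2 : Tendsto (fun r : ℝ => r / √(1 + r ^ 2)) atTop (𝓝 1) := by
      refine h1.congr' ?_
      filter_upwards [eventually_gt_atTop 0] with r hr
      have : √(1 + r ^ 2) = r * √(1 + (r⁻¹) ^ 2) := by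
        rw [← Real.sqrt_sq hr.le, ← Real.sqrt_mul (by positivity), Real.sqrt_sq hr.le]
        congr 1
        field_simp
        ring
      rw [this, div_mul_eq_div_div, div_self hr.ne', one_div]
    have h3 := (h2.pow 3).const_mul (1 / 3)
    rwa [one_pow, mul_one] at h3
  have := integral_Ioi_of_hasDerivAt_of_nonneg' (a := 0) (fun r _ => hder r)
    (fun r _ => by positivity) hlim
  rw [this]
  norm_num

/-- The density of the regularized point source of unit strength. -/
noncomputable def sourceDensity (z : E3) : ℝ := 3 / (4 * Real.pi) * (√(1 + ‖z‖ ^ 2) ^ 5)⁻¹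

theorem integral_sourceDensity : ∫ z, sourceDensity z = 1 := by
  have h := integral_fun_norm_addHaar (volume : Measure E3)
    (fun r : ℝ => 3 / (4 * Real.pi) * (√(1 + r ^ 2) ^ 5)⁻¹)
  have hd : Module.finrank ℝ E3 = 3 := by simp
  have hb : (volume : Measure E3).real (Metric.ball 0 1) = 4 * Real.pi / 3 := by
    rw [measureReal_def, EuclideanSpace.volume_ball_fin_three]
    rw [ENNReal.toReal_mul, ENNReal.toReal_ofReal (by positivity)]
    simp
    ring
  rw [hd, hb] at h
  have e : ∫ r in Ioi (0 : ℝ), r ^ (3 - 1) • (3 / (4 * Real.pi) * (√(1 + r ^ 2) ^ 5)⁻¹) =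
      3 / (4 * Real.pi) * (1 / 3) := by
    rw [← integral_Ioi_sq_div_sqrt_pow, ← integral_const_mul]
    refine integral_congr_ae (Eventually.of_forall fun r => ?_)
    simp only [smul_eq_mul]
    ring
  rw [e] at h
  change ∫ z, sourceDensity z = _ at h
  rw [h]
  simp only [smul_eq_mul, nsmul_eq_mul]
  push_cast
  field_simp

theorem sourceDensity_nonneg (z : E3) : 0 ≤ sourceDensity z := by
  unfold sourceDensity; positivity

/-- The density decays like `‖z‖⁻⁵`. Decay faster than `‖z‖⁻³` lets its rescalings act as an
approximate identity on functions that are integrable and continuous at one point. -/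
theorem tendsto_norm_pow_mul_sourceDensity :
    Tendsto (fun z : E3 => ‖z‖ ^ Module.finrank ℝ E3 * sourceDensity z)
      (Bornology.cobounded E3) (𝓝 0) := by
  have hd : Module.finrank ℝ E3 = 3 := by simp
  rw [hd]
  have h1 : Tendsto (fun z : E3 => 3 / (4 * Real.pi) * (‖z‖ ^ 2)⁻¹) (Bornology.cobounded E3)
      (𝓝 0) := by
    have : Tendsto (fun z : E3 => ‖z‖ ^ 2) (Bornology.cobounded E3) atTop :=
      (tendsto_pow_atTop two_ne_zero).comp tendsto_norm_cobounded_atTop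
    simpa using (tendsto_inv_atTop_zero.comp this).const_mul (3 / (4 * Real.pi))
  refine squeeze_zero' (Eventually.of_forall fun z =>
    mul_nonneg (by positivity) (sourceDensity_nonneg z)) ?_ h1
  filter_upwards [tendsto_norm_cobounded_atTop.eventually (eventually_gt_atTop 0)] with z hz
  have hle : ‖z‖ ≤ √(1 + ‖z‖ ^ 2) := Real.le_sqrt_of_sq_le (by linarith)
  have h5 : ‖z‖ ^ 5 ≤ √(1 + ‖z‖ ^ 2) ^ 5 := by gcongr
  have h6 : (√(1 + ‖z‖ ^ 2) ^ 5)⁻¹ ≤ (‖z‖ ^ 5)⁻¹ := inv_anti₀ (by positivity) h5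
  calc ‖z‖ ^ 3 * sourceDensity z ≤ ‖z‖ ^ 3 * (3 / (4 * Real.pi) * (‖z‖ ^ 5)⁻¹) := by
        unfold sourceDensity; gcongr
    _ = 3 / (4 * Real.pi) * (‖z‖ ^ 2)⁻¹ := by field_simp

theorem sourceDensity_scaled {c : ℝ} (hc : 0 < c) (y x : E3) :
    4 * Real.pi * (c ^ 3 * sourceDensity (c • (y - x))) =
      -divergence (regGrad c⁻¹ y) x := by
  rw [divergence_regGrad (inv_pos.2 hc), neg_neg, sourceDensity, norm_smul, norm_sub_rev,
    Real.norm_of_nonneg hc.le]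
  have e : √(1 + (c * ‖x - y‖) ^ 2) = c * regDist c⁻¹ y x := by
    rw [regDist, ← Real.sqrt_sq hc.le, ← Real.sqrt_mul (by positivity), Real.sqrt_sq hc.le]
    congr 1
    field_simp
    ring
  rw [e]
  have := regDist_pos (inv_pos.2 hc) y x
  field_simp

/-- The integrals are `4π` times mollifications at `y` of `u` extended by zero. That extension is
continuous at `y`: in the interior trivially, on the boundary because `u y = 0`, so no solid angle
enters. -/
theorem tendsto_setIntegral_mul_divergence_regGrad {D : Set E3} (hD : IsLipschitzDomain D)
    {u : E3 → ℝ} (hu : ContinuousOn u (closure D)) {y : E3} (hy : y ∈ closure D)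
    (hyu : y ∈ D ∨ u y = 0) :
    Tendsto (fun c : ℝ => ∫ x in D, u x * -divergence (regGrad c⁻¹ y) x) atTop
      (𝓝 (4 * Real.pi * u y)) := by
  have hDm := hD.isOpen.measurableSet
  have hint : Integrable (D.indicator u) :=
    ((hu.integrableOn_compact hD.isCompact_closure).mono_set subset_closure).integrable_indicator
      hDm
  have hval : D.indicator u y = u y := by
    rcases hyu with h | h
    · exact indicator_of_mem h u
    · by_cases hyD : y ∈ D <;> simp [hyD, h]
  have hcont : ContinuousAt (D.indicator u) y := by
    by_cases hyD : y ∈ D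
    · have h1 : ContinuousAt u y :=
        hu.continuousAt (mem_of_superset (hD.isOpen.mem_nhds hyD) subset_closure)
      refine h1.congr ?_
      filter_upwards [hD.isOpen.mem_nhds hyD] with z hz using (indicator_of_mem hz u).symm
    · have h0 : u y = 0 := hyu.resolve_left hyD
      rw [Metric.continuousAt_iff]
      intro ε hε
      obtain ⟨r, hr, h⟩ := Metric.continuousWithinAt_iff.1 (hu y hy) ε hε
      refine ⟨r, hr, fun x hx => ?_⟩
      rw [hval]
      by_cases hxD : x ∈ D
      · rw [indicator_of_mem hxD]
        exact h (subset_closure hxD) hx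
      · rw [indicator_of_notMem hxD, h0, dist_self]
        exact hε
  have key := (tendsto_integral_comp_smul_smul_of_integrable' (μ := (volume : Measure E3))
    sourceDensity_nonneg integral_sourceDensity tendsto_norm_pow_mul_sourceDensity hint
    hcont).const_mul (4 * Real.pi)
  rw [hval] at key
  refine key.congr' ?_
  filter_upwards [eventually_gt_atTop 0] with c hc
  rw [← integral_const_mul, ← integral_indicator hDm]
  refine integral_congr_ae (Eventually.of_forall fun x => ?_)
  have hd : Module.finrank ℝ E3 = 3 := by simp
  by_cases hx : x ∈ D
  · simp only [hd, indicator_of_mem hx, smul_eq_mul]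
    rw [← sourceDensity_scaled hc]
    ring
  · simp [hx]

/-! ### Representation of harmonic functions -/

theorem regDist_zero (y x : E3) : regDist 0 y x = ‖x - y‖ := by
  simp [regDist, Real.sqrt_sq (norm_nonneg _)]

theorem greenG_eq (x y : E3) : greenG x y = (regDist 0 y x)⁻¹ := by
  rw [greenG, regDist_zero, one_div]

theorem continuous_regDist_left (y x : E3) : Continuous fun δ => regDist δ y x :=
  Real.continuous_sqrt.comp (by fun_prop)

theorem norm_regGrad_le {δ : ℝ} {y x : E3} (hxy : x ≠ y) :
    ‖regGrad δ y x‖ ≤ (‖x - y‖ ^ 2)⁻¹ := by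
  have h0 : 0 < ‖x - y‖ := norm_pos_iff.2 (sub_ne_zero.2 hxy)
  have h1 := norm_sub_le_regDist δ y x
  have h2 : 0 < regDist δ y x := h0.trans_le h1
  rw [regGrad, norm_smul, norm_neg, norm_inv, norm_pow, Real.norm_of_nonneg h2.le]
  calc (regDist δ y x ^ 3)⁻¹ * ‖x - y‖ ≤ (‖x - y‖ ^ 3)⁻¹ * ‖x - y‖ := by gcongr
    _ = (‖x - y‖ ^ 2)⁻¹ := by field_simp

theorem inv_regDist_le {δ : ℝ} {y x : E3} (hxy : x ≠ y) : (regDist δ y x)⁻¹ ≤ ‖x - y‖⁻¹ :=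
  inv_anti₀ (norm_pos_iff.2 (sub_ne_zero.2 hxy)) (norm_sub_le_regDist δ y x)

theorem measurable_regDist (δ : ℝ) (y : E3) : Measurable (regDist δ y) :=
  Continuous.measurable (Real.continuous_sqrt.comp (by fun_prop))

theorem measurable_regGrad (δ : ℝ) (y : E3) : Measurable (regGrad δ y) :=
  ((measurable_regDist δ y).pow_const 3).inv.neg.smul (measurable_id.sub_const y)

theorem IsLipschitzDomain.normalDerivG_eq {D : Set E3} (hD : IsLipschitzDomain D) {x y : E3}
    (hx : x ∈ closure D) (hxy : x ≠ y) :
    normalDerivG D x y = inner ℝ (regGrad 0 y x) (outwardNormal D x) := by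
  have hpos : 0 < regDist 0 y x := by
    rw [regDist_zero]; exact norm_pos_iff.2 (sub_ne_zero.2 hxy)
  have h1 : HasGradientAt (fun z => greenG z y) (regGrad 0 y x) x := by
    simp_rw [greenG_eq]
    exact hasGradientAt_inv_regDist hpos
  have h2 := h1.hasFDerivAt.hasFDerivWithinAt.fderivWithin (hD.uniqueDiffOn_closure x hx)
  rw [normalDerivG, normalDeriv, gradientWithin, h2, LinearIsometryEquiv.symm_apply_apply]

theorem ae_surfaceMeasure_mem_and_ne (D : Set E3) (y : E3) :
    ∀ᵐ x ∂surfaceMeasure D, x ∈ frontier D ∧ x ≠ y := by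
  refine (ae_restrict_mem isClosed_frontier.measurableSet).and ?_
  exact compl_mem_ae_iff.2 (surfaceMeasure_singleton D y)

/-- One power of `‖x - y‖` is gained against the `‖x - y‖⁻²` singularity of `∂G/∂n`. Near a boundary
point `y` it comes from differentiability and `u y = 0`; near an interior `y` there are no boundary
points. -/
theorem IsHarmonicC1.exists_abs_le_norm_sub {D : Set E3} {u : E3 → ℝ} (hu : IsHarmonicC1 D u)
    (hD : IsLipschitzDomain D) {y : E3} (hy : y ∈ closure D) (hyu : y ∈ D ∨ u y = 0) :
    ∃ C, 0 ≤ C ∧ ∀ x ∈ frontier D, |u x| ≤ C * ‖x - y‖ := by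
  obtain ⟨M, hM⟩ := hD.isCompact_closure.exists_bound_of_continuousOn hu.continuousOn
  have hloc : ∃ C, ∀ᶠ x in 𝓝 y, x ∈ frontier D → |u x| ≤ C * ‖x - y‖ := by
    by_cases hyD : y ∈ D
    · refine ⟨0, ?_⟩
      filter_upwards [hD.isOpen.mem_nhds hyD] with x hx hxf
      rw [hD.isOpen.frontier_eq] at hxf
      exact absurd hx hxf.2
    · have h0 : u y = 0 := hyu.resolve_left hyD
      have hd : DifferentiableWithinAt ℝ u (closure D) y :=
        (hu.contDiffOn.differentiableOn one_ne_zero) y hy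
      obtain ⟨C, hC⟩ := hd.hasFDerivWithinAt.isBigO_sub.bound
      refine ⟨C, ?_⟩
      rw [eventually_nhdsWithin_iff] at hC
      filter_upwards [hC] with x hx hxf
      have := hx (frontier_subset_closure hxf)
      rwa [h0, sub_zero] at this
  obtain ⟨C, hC⟩ := hloc
  obtain ⟨r, hr, hball⟩ := Metric.eventually_nhds_iff.1 hC
  -- `|C|` serves within distance `r` of `y`, and `|M| / r` beyond it, where `u` is merely bounded.
  refine ⟨max |C| (|M| / r), le_max_of_le_left (abs_nonneg _), fun x hx => ?_⟩
  by_cases hxr : dist x y < r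
  · refine (hball hxr hx).trans ?_
    gcongr
    exact (le_abs_self C).trans (le_max_left _ _)
  · have h1 : |u x| ≤ |M| := (hM x (frontier_subset_closure hx)).trans (le_abs_self M)
    rw [dist_eq_norm, not_lt] at hxr
    calc |u x| ≤ |M| / r * r := by rw [div_mul_cancel₀ _ hr.ne']; exact h1
      _ ≤ max |C| (|M| / r) * ‖x - y‖ := by
        gcongr
        exact le_max_right _ _

theorem IsHarmonicC1.integrable_normalDeriv {D : Set E3} {u : E3 → ℝ} (hu : IsHarmonicC1 D u)
    (hD : IsLipschitzDomain D) : Integrable (normalDeriv D u) (surfaceMeasure D) :=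
  hD.integrable_flux (hu.continuousOn_gradientWithin hD)

theorem IsHarmonicC1.exists_abs_normalDeriv_le {D : Set E3} {u : E3 → ℝ} (hu : IsHarmonicC1 D u)
    (hD : IsLipschitzDomain D) : ∃ M, ∀ x ∈ frontier D, |normalDeriv D u x| ≤ M := by
  obtain ⟨M, hM⟩ := hD.isCompact_closure.exists_bound_of_continuousOn
    (hu.continuousOn_gradientWithin hD)
  refine ⟨M, fun x hx => ?_⟩
  have h1 := hM x (frontier_subset_closure hx)
  have h2 := norm_outwardNormal_le D x
  refine (norm_inner_le_norm (𝕜 := ℝ) (gradientWithin u (closure D) x)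
    (outwardNormal D x)).trans ?_
  nlinarith [norm_nonneg (gradientWithin u (closure D) x), norm_nonneg (outwardNormal D x)]

/-- Green's representation formula at a point of the closure which lies in the domain or at which
the function vanishes. -/
theorem IsHarmonicC1.representation {D : Set E3} {u : E3 → ℝ} (hu : IsHarmonicC1 D u)
    (hD : IsLipschitzDomain D) {y : E3} (hy : y ∈ closure D) (hyu : y ∈ D ∨ u y = 0) :
    Integrable (fun x => u x * normalDerivG D x y) (surfaceMeasure D) ∧
    Integrable (fun x => normalDeriv D u x * greenG x y) (surfaceMeasure D) ∧
    4 * Real.pi * u y = (∫ x, normalDeriv D u x * greenG x y ∂surfaceMeasure D) -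
      ∫ x, u x * normalDerivG D x y ∂surfaceMeasure D := by
  obtain ⟨C, hC0, hC⟩ := hu.exists_abs_le_norm_sub hD hy hyu
  obtain ⟨M, hM⟩ := hu.exists_abs_normalDeriv_le hD
  have hr := hD.integrable_inv_norm_sub y
  have hae := ae_surfaceMeasure_mem_and_ne D y
  have hnm := hD.integrable_outwardNormal.aestronglyMeasurable
  have hum : AEStronglyMeasurable u (surfaceMeasure D) :=
    (hu.continuousOn.mono frontier_subset_closure).aestronglyMeasurable
      isClosed_frontier.measurableSet
  have hdm := (hu.integrable_normalDeriv hD).aestronglyMeasurable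
  have hm1 : ∀ δ, AEStronglyMeasurable (fun x => normalDeriv D u x * (regDist δ y x)⁻¹)
      (surfaceMeasure D) := fun δ =>
    hdm.mul (measurable_regDist δ y).inv.aestronglyMeasurable
  have hm2 : ∀ δ, AEStronglyMeasurable
      (fun x => u x * inner ℝ (regGrad δ y x) (outwardNormal D x)) (surfaceMeasure D) := fun δ =>
    hum.mul ((measurable_regGrad δ y).aestronglyMeasurable.inner hnm)
  -- The bounds do not depend on `δ`: they dominate the limit `δ → 0` and, at `δ = 0`, give the
  -- absolute convergence claimed.
  have hb1 : ∀ δ, ∀ᵐ x ∂surfaceMeasure D,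
      ‖normalDeriv D u x * (regDist δ y x)⁻¹‖ ≤ M * ‖x - y‖⁻¹ := by
    intro δ
    filter_upwards [hae] with x ⟨hx, hxy⟩
    have h0 : 0 ≤ (regDist δ y x)⁻¹ := inv_nonneg.2 (Real.sqrt_nonneg _)
    rw [norm_mul, Real.norm_of_nonneg h0]
    exact mul_le_mul (hM x hx) (inv_regDist_le hxy) h0 ((abs_nonneg _).trans (hM x hx))
  have hb2 : ∀ δ, ∀ᵐ x ∂surfaceMeasure D,
      ‖u x * inner ℝ (regGrad δ y x) (outwardNormal D x)‖ ≤ C * ‖x - y‖⁻¹ := by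
    intro δ
    filter_upwards [hae] with x ⟨hx, hxy⟩
    have h0 : 0 < ‖x - y‖ := norm_pos_iff.2 (sub_ne_zero.2 hxy)
    have h1 : ‖inner ℝ (regGrad δ y x) (outwardNormal D x)‖ ≤ (‖x - y‖ ^ 2)⁻¹ := by
      refine (norm_inner_le_norm _ _).trans ?_
      have := norm_regGrad_le (δ := δ) hxy
      have := norm_outwardNormal_le D x
      nlinarith [norm_nonneg (regGrad δ y x), norm_nonneg (outwardNormal D x)]
    rw [norm_mul]
    calc ‖u x‖ * ‖inner ℝ (regGrad δ y x) (outwardNormal D x)‖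
        ≤ (C * ‖x - y‖) * (‖x - y‖ ^ 2)⁻¹ := by
          refine mul_le_mul (hC x hx) h1 (norm_nonneg _) (by positivity)
      _ = C * ‖x - y‖⁻¹ := by field_simp
  have hi1 : ∀ δ, Integrable (fun x => normalDeriv D u x * (regDist δ y x)⁻¹)
      (surfaceMeasure D) := fun δ => (hr.const_mul M).mono' (hm1 δ) (hb1 δ)
  have hi2 : ∀ δ, Integrable (fun x => u x * inner ℝ (regGrad δ y x) (outwardNormal D x))
      (surfaceMeasure D) := fun δ => (hr.const_mul C).mono' (hm2 δ) (hb2 δ)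
  have hG : (fun x => normalDeriv D u x * (regDist 0 y x)⁻¹) =
      fun x => normalDeriv D u x * greenG x y := by
    ext x; rw [greenG_eq]
  have hN : (fun x => u x * inner ℝ (regGrad 0 y x) (outwardNormal D x)) =ᵐ[surfaceMeasure D]
      fun x => u x * normalDerivG D x y := by
    filter_upwards [hae] with x ⟨hx, hxy⟩
    rw [hD.normalDerivG_eq (frontier_subset_closure hx) hxy]
  have hlim1 : Tendsto (fun c : ℝ => ∫ x, normalDeriv D u x * (regDist c⁻¹ y x)⁻¹
      ∂surfaceMeasure D) atTop (𝓝 (∫ x, normalDeriv D u x * (regDist 0 y x)⁻¹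
      ∂surfaceMeasure D)) := by
    refine tendsto_integral_filter_of_dominated_convergence (fun x => M * ‖x - y‖⁻¹)
      (Eventually.of_forall fun c => hm1 _) (Eventually.of_forall fun c => hb1 _)
      (hr.const_mul M) ?_
    filter_upwards [hae] with x ⟨hx, hxy⟩
    have h1 := ((continuous_regDist_left y x).tendsto 0).comp tendsto_inv_atTop_zero
    refine (h1.inv₀ ?_).const_mul _
    rw [regDist_zero]
    exact norm_ne_zero_iff.2 (sub_ne_zero.2 hxy)
  have hlim2 : Tendsto (fun c : ℝ => ∫ x, u x * inner ℝ (regGrad c⁻¹ y x) (outwardNormal D x)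
      ∂surfaceMeasure D) atTop (𝓝 (∫ x, u x * inner ℝ (regGrad 0 y x) (outwardNormal D x)
      ∂surfaceMeasure D)) := by
    refine tendsto_integral_filter_of_dominated_convergence (fun x => C * ‖x - y‖⁻¹)
      (Eventually.of_forall fun c => hm2 _) (Eventually.of_forall fun c => hb2 _)
      (hr.const_mul C) ?_
    filter_upwards [hae] with x ⟨hx, hxy⟩
    have h1 := ((continuous_regDist_left y x).tendsto 0).comp tendsto_inv_atTop_zero
    have h2 : regDist 0 y x ^ 3 ≠ 0 := by
      rw [regDist_zero]
      exact pow_ne_zero 3 (norm_ne_zero_iff.2 (sub_ne_zero.2 hxy))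
    have h3 := (((h1.pow 3).inv₀ h2).neg.smul_const (x - y))
    exact (h3.inner tendsto_const_nhds).const_mul _
  -- For `δ = c⁻¹ > 0` the kernel is smooth everywhere, including at `y`, so Green's identity
  -- applies on all of `D`.
  have hgreen : ∀ᶠ c : ℝ in atTop, (∫ x in D, u x * -divergence (regGrad c⁻¹ y) x) =
      (∫ x, normalDeriv D u x * (regDist c⁻¹ y x)⁻¹ ∂surfaceMeasure D) -
        ∫ x, u x * inner ℝ (regGrad c⁻¹ y x) (outwardNormal D x) ∂surfaceMeasure D := by
    filter_upwards [eventually_gt_atTop 0] with c hc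
    have hδ := inv_pos.2 hc
    rw [← integral_sub (hi1 _) (hi2 _)]
    exact hu.green hD (contDiff_regGrad hδ y)
      ((contDiff_regDist hδ y).inv fun x => (regDist_pos hδ y x).ne')
      fun x => hasGradientAt_inv_regDist (regDist_pos hδ y x)
  have hlim := tendsto_setIntegral_mul_divergence_regGrad hD hu.continuousOn hy hyu
  refine ⟨(hi2 0).congr hN, hG ▸ hi1 0, ?_⟩
  have := tendsto_nhds_unique (hlim.congr' hgreen) (hlim1.sub hlim2)
  rw [this, hG, integral_congr_ae hN]

/-! ### Subtracting `ψ` and conclusion -/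

theorem IsHarmonicC1.sub_psi {D : Set E3} {φ f : E3 → ℝ} (hφ : IsHarmonicC1 D φ)
    (hf : IsHarmonicC1 D f) (x₀ : E3) : IsHarmonicC1 D fun x => φ x - psi D φ f x₀ x where
  harmonic := by
    have h : HarmonicOnNhd (φ - ((fun _ => φ x₀) + normalDeriv D φ x₀ • f)) D :=
      hφ.harmonic.sub ((harmonicOnNhd_const _).add (hf.harmonic.const_smul))
    exact h
  contDiffOn := hφ.contDiffOn.sub (contDiffOn_const.add (contDiffOn_const.mul hf.contDiffOn))

theorem normalDeriv_sub_psi {D : Set E3} (hD : IsLipschitzDomain D) {φ f : E3 → ℝ}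
    (hφ : IsHarmonicC1 D φ) (hf : IsHarmonicC1 D f) (x₀ : E3) {x : E3} (hx : x ∈ closure D) :
    normalDeriv D (fun x => φ x - psi D φ f x₀ x) x =
      normalDeriv D φ x - normalDeriv D φ x₀ * normalDeriv D f x := by
  have hu := hD.uniqueDiffOn_closure x hx
  have h1 := (hφ.contDiffOn.differentiableOn one_ne_zero x hx).hasFDerivWithinAt
  have h2 := (hf.contDiffOn.differentiableOn one_ne_zero x hx).hasFDerivWithinAt
  have h3 := (h1.sub ((h2.const_mul (normalDeriv D φ x₀)).const_add (φ x₀))).fderivWithin hu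
  have h4 : fderivWithin ℝ (fun x => φ x - psi D φ f x₀ x) (closure D) x =
      fderivWithin ℝ φ (closure D) x - normalDeriv D φ x₀ • fderivWithin ℝ f (closure D) x := h3
  generalize normalDeriv D φ x₀ = c at h4
  simp only [normalDeriv, inner_gradientWithin_left, h4]
  simp

end

theorem mainTheorem2 (D : Set E3) (hD : IsLipschitzDomain D)
    (φ f : E3 → ℝ) (hφ : IsHarmonicC1 D φ) (hf : IsHarmonicC1 D f)
    (x₀ : E3) (hx₀ : x₀ ∈ frontier D) (hn₀ : ∃ ν, IsOutwardUnitNormal D x₀ ν)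
    (hf₀ : f x₀ = 0) (hf₁ : normalDeriv D f x₀ = 1)
    (xp : E3) (hxp : xp ∈ D) :
    Integrable (fun x => (φ x - psi D φ f x₀ x) *
      (normalDerivG D x xp - normalDerivG D x x₀)) (surfaceMeasure D) ∧
    Integrable (fun x => (normalDeriv D φ x - normalDeriv D φ x₀ * normalDeriv D f x) *
      (greenG x xp - greenG x x₀)) (surfaceMeasure D) ∧
    φ xp = φ x₀ + normalDeriv D φ x₀ * f xp
      - 1 / (4 * Real.pi) * ∫ x, (φ x - psi D φ f x₀ x) *
          (normalDerivG D x xp - normalDerivG D x x₀) ∂(surfaceMeasure D)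
      + 1 / (4 * Real.pi) * ∫ x, (normalDeriv D φ x - normalDeriv D φ x₀ * normalDeriv D f x) *
          (greenG x xp - greenG x x₀) ∂(surfaceMeasure D) := by
  have hu := hφ.sub_psi hf x₀
  have hu0 : φ x₀ - psi D φ f x₀ x₀ = 0 := by simp [psi, hf₀]
  -- The instance at `x₀` has left side zero; subtracting it from the one at `xp` turns each kernel
  -- into a difference of kernels.
  obtain ⟨p1, p2, p3⟩ := hu.representation hD (subset_closure hxp) (Or.inl hxp)
  obtain ⟨q1, q2, q3⟩ := hu.representation hD (frontier_subset_closure hx₀) (Or.inr hu0)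
  have e1 : (fun x => (φ x - psi D φ f x₀ x) * (normalDerivG D x xp - normalDerivG D x x₀)) =
      fun x => (φ x - psi D φ f x₀ x) * normalDerivG D x xp -
        (φ x - psi D φ f x₀ x) * normalDerivG D x x₀ := by
    ext x; ring
  -- Linearity of the normal derivative is available on the closure of `D`, so the two integrands
  -- agree only almost everywhere for the surface measure.
  have e2 : (fun x => normalDeriv D (fun x => φ x - psi D φ f x₀ x) x * greenG x xp -
      normalDeriv D (fun x => φ x - psi D φ f x₀ x) x * greenG x x₀) =ᵐ[surfaceMeasure D]
      fun x => (normalDeriv D φ x - normalDeriv D φ x₀ * normalDeriv D f x) *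
        (greenG x xp - greenG x x₀) := by
    filter_upwards [ae_restrict_mem isClosed_frontier.measurableSet] with x hx
    rw [normalDeriv_sub_psi hD hφ hf x₀ (frontier_subset_closure hx)]
    ring
  rw [e1]
  refine ⟨p1.sub q1, (p2.sub q2).congr e2, ?_⟩
  rw [integral_sub p1 q1, ← integral_congr_ae e2, integral_sub p2 q2]
  have hpsi : psi D φ f x₀ xp = φ x₀ + normalDeriv D φ x₀ * f xp := rfl
  rw [hu0, mul_zero] at q3
  have hpi := Real.pi_pos
  rw [← hpsi]
  field_simp
  linarith
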